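/- Let $d\ge 1$ be an integer, $\tau>0$, $s\in\mathbb R$, $h\ge\tau$, and put $X=L^2([-\tau,0],\mathbb R^d)$, $X^+=L^2([0,h],\mathbb R^d)$, $H^{1,+}=H^1([0,h],\mathbb R^d)$ with $\|w\|_{H^{1,+}}^2=\|w\|_{X^+}^2+\|w'\|_{X^+}^2$. Let $C(t,\theta)\in\mathbb R^{d\times d}$ be a matrix-valued kernel. For $\phi\in X$ and $w\in X^+$ let $V(\phi,w)$ be the function on $[-\tau,h]$ equal to $\phi$ on $[-\tau,0]$ and to $w$ on $(0,h]$; for $v\in L^2([-\tau,h],\mathbb R^d)$ let $$(\mathcal F v)(t)=\int_{-\tau}^0 C(s+t,\theta)\,v(t+\theta)\,d\theta,\qquad t\in[0,h].$$ Assume: (H1) $C\in L^\infty([s,s+h]\times[-\tau,0],\mathbb R^{d\times d})$; (H2) $w\mapsto \mathcal F V(0,w)$ maps $X^+$ into $H^{1,+}$ and is bounded from $X^+$ to $H^{1,+}$; (H3) $\phi\mapsto \mathcal F V(\phi,0)$ maps $X$ into $H^{1,+}$ and is bounded from $X$ to $H^{1,+}$. For $N\ge1$ let $\mathcal L_N$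 be Lagrange interpolation at the zeros of the Legendre polynomial of degree $N$ on $[0,h]$, applied to elements of $H^{1,+}$ through their continuous representatives. Then: 1. For every $\phi\in X$ there is a unique $x\in L^2([s-\tau,s+h],\mathbb R^d)$ with $x(s+\theta)=\phi(\theta)$ for a.e. $\theta\in[-\tau,0]$ and $x(t)=\int_{-\tau}^0C(t,\theta)x(t+\theta)\,d\theta$ for a.e. $t\in(s,s+h)$, and $(T\phi)(\theta)=x(s+h+\theta)$, $\theta\in[-\tau,0]$, defines a bounded linear operator $T\colon X\to X$ (the evolution operator $T(s+h,s)$). 2. There is $N_0$ such that for all $N\ge N_0$ and all $\phi\in X$ the equation $w=\mathcal L_N\mathcal F V(\phi,w)$ has a unique solution $w^*_N\in X^+$, and $(T_N\phi)(\theta)=V(\phi,w^*_N)(h+\theta)$, $\theta\in[-\tau,0]$, defines a bounded linear operator $T_N\colon X\to X$. 3. $\|T_N-T\|_{X\leftarrow X}\to0$ as $N\to\infty$. -/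

import Mathlib

open MeasureTheory Set Filter Topology
open scoped ENNReal ContDiff

noncomputable section

namespace RenewalEq

/-- `ℝ^d` with the Euclidean norm. -/
abbrev Vec (d : ℕ) : Type := EuclideanSpace ℝ (Fin d)

/-- `L²([a,b], ℝ^d)`. -/
abbrev L2 (d : ℕ) (a b : ℝ) : Type := Lp (Vec d) 2 (volume.restrict (Icc a b))

/-- `g` is the weak derivative of `f` on `(a,b)`: both are in `L²`, and
`∫ η' f = - ∫ η g` for every test function `η ∈ C_c^∞((a,b))`. -/
def IsWeakDeriv {d : ℕ} {a b : ℝ} (f g : L2 d a b) : Prop :=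
  ∀ η : ℝ → ℝ, ContDiff ℝ ∞ η → HasCompactSupport η → tsupport η ⊆ Ioo a b →
    ∫ t in Icc a b, deriv η t • f t = - ∫ t in Icc a b, η t • g t

lemma integrable_smul_L2 {d : ℕ} {a b : ℝ} (f : L2 d a b) {η : ℝ → ℝ}
    (hη : Continuous η) (hc : HasCompactSupport η) :
    Integrable (fun t => η t • f t) (volume.restrict (Icc a b)) := by
  obtain ⟨C, hC⟩ := hc.exists_bound_of_continuous hη
  exact ((Lp.memLp f).integrable (by norm_num)).bdd_smul C
    hη.aestronglyMeasurable (Eventually.of_forall hC)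

/-- The Sobolev space `H¹([a,b], ℝ^d)`, realised as the space of pairs `(f, f')` with `f ∈ L²` and
`f' ∈ L²` the weak derivative of `f`. The norm is the one inherited from the Hilbert product
`L² × L²`, that is `‖f‖²_{H¹} = ‖f‖²_{L²} + ‖f'‖²_{L²}`. -/
def H1 (d : ℕ) (a b : ℝ) : Submodule ℝ (WithLp 2 (L2 d a b × L2 d a b)) where
  carrier := {p | IsWeakDeriv p.fst p.snd}
  zero_mem' := by
    intro η _ _ _
    have h0 := Lp.coeFn_zero (Vec d) 2 (volume.restrict (Icc a b))
    have h1 : ∀ ζ : ℝ → ℝ, ∫ t in Icc a b, ζ t • (0 : L2 d a b) t = 0 := by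
      intro ζ
      refine integral_eq_zero_of_ae ?_
      filter_upwards [h0] with t ht
      rw [ht]; simp
    change ∫ t in Icc a b, deriv η t • (0 : L2 d a b) t
      = - ∫ t in Icc a b, η t • (0 : L2 d a b) t
    rw [h1, h1, neg_zero]
  add_mem' := by
    intro p q hp hq η h1 h2 h3
    have key : ∀ (f g : L2 d a b) (ζ : ℝ → ℝ), Continuous ζ → HasCompactSupport ζ →
        ∫ t in Icc a b, ζ t • (f + g : L2 d a b) t
          = (∫ t in Icc a b, ζ t • f t) + ∫ t in Icc a b, ζ t • g t := by
      intro f g ζ hζ hζc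
      rw [← integral_add (integrable_smul_L2 f hζ hζc) (integrable_smul_L2 g hζ hζc)]
      refine integral_congr_ae ?_
      filter_upwards [Lp.coeFn_add f g] with t ht
      rw [ht, Pi.add_apply, smul_add]
    change ∫ t in Icc a b, deriv η t • (p.fst + q.fst : L2 d a b) t
      = - ∫ t in Icc a b, η t • (p.snd + q.snd : L2 d a b) t
    rw [key _ _ _ (h1.continuous_deriv (by simp)) h2.deriv, key _ _ _ h1.continuous h2,
      hp η h1 h2 h3, hq η h1 h2 h3, neg_add]
  smul_mem' := by
    intro c p hp η h1 h2 h3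
    have key : ∀ (f : L2 d a b) (ζ : ℝ → ℝ),
        ∫ t in Icc a b, ζ t • (c • f : L2 d a b) t = c • ∫ t in Icc a b, ζ t • f t := by
      intro f ζ
      rw [← integral_smul]
      refine integral_congr_ae ?_
      filter_upwards [Lp.coeFn_smul c f] with t ht
      rw [ht, Pi.smul_apply, smul_comm]
    change ∫ t in Icc a b, deriv η t • (c • p.fst : L2 d a b) t
      = - ∫ t in Icc a b, η t • (c • p.snd : L2 d a b) t
    rw [key, key, hp η h1 h2 h3, smul_neg]

/-- The element of `L²` underlying an element of `H¹`. -/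
def H1.toL2 {d : ℕ} {a b : ℝ} (u : H1 d a b) : L2 d a b := u.1.fst

/-- `x ∈ L²([s-τ,s+h], ℝ^d)` solves the initial value problem
`x(t) = ∫_{-τ}^0 C(t,θ) x(t+θ) dθ` for (almost every) `t ∈ (s,s+h)`, `x_s = φ`. -/
def IsSolution {d : ℕ} (τ s h : ℝ) (C : ℝ → ℝ → Matrix (Fin d) (Fin d) ℝ)
    (φ : L2 d (-τ) 0) (x : L2 d (s - τ) (s + h)) : Prop :=
  (∀ᵐ θ ∂volume.restrict (Icc (-τ) 0), x (s + θ) = φ θ) ∧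
  ∀ᵐ t ∂volume.restrict (Ioc s (s + h)),
    x t = ∫ θ in Icc (-τ) 0, (C t θ).toEuclideanLin (x (t + θ))

/-- `T` is the evolution operator `T(s+h,s)`: `T φ = x_{s+h}` for the solution `x` of the initial
value problem at time `s` with datum `φ`. -/
def IsEvolutionOperator {d : ℕ} (τ s h : ℝ) (C : ℝ → ℝ → Matrix (Fin d) (Fin d) ℝ)
    (T : L2 d (-τ) 0 →L[ℝ] L2 d (-τ) 0) : Prop :=
  ∀ (φ : L2 d (-τ) 0) (x : L2 d (s - τ) (s + h)), IsSolution τ s h C φ x →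
    T φ =ᵐ[volume.restrict (Icc (-τ) 0)] fun θ => x (s + h + θ)

/-- `V(φ,w)`, equal to `w` on `(0,h]` and to `φ` on `[-τ,0]`. -/
def V {d : ℕ} (φ w : ℝ → Vec d) (t : ℝ) : Vec d := if 0 < t then w t else φ t

/-- `(𝓕 v)(t) = ∫_{-τ}^0 C(s+t,θ) v(t+θ) dθ`; for `t ∈ [0,h]` it involves only the values of `v` on
`[-τ,h]`. -/
def opF {d : ℕ} (τ s : ℝ) (C : ℝ → ℝ → Matrix (Fin d) (Fin d) ℝ) (v : ℝ → Vec d) (t : ℝ) : Vec d :=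
  ∫ θ in Icc (-τ) 0, (C (s + t) θ).toEuclideanLin (v (t + θ))

/-- `C ∈ L^∞([s,s+h] × [-τ,0], ℝ^{d×d})`, stated entrywise. -/
def HypC {d : ℕ} (τ s h : ℝ) (C : ℝ → ℝ → Matrix (Fin d) (Fin d) ℝ) : Prop :=
  ∀ i j, MemLp (fun p : ℝ × ℝ => C p.1 p.2 i j) ∞
    (volume.restrict (Icc s (s + h) ×ˢ Icc (-τ) 0))

/-- `𝓕 V⁺`, with `V⁺ w = V(0,w)`, is a bounded operator from `L²([0,h])` to `H¹([0,h])`. -/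
def HypPlus {d : ℕ} (τ s h : ℝ) (C : ℝ → ℝ → Matrix (Fin d) (Fin d) ℝ) : Prop :=
  ∃ A : L2 d 0 h →L[ℝ] H1 d 0 h, ∀ w : L2 d 0 h,
    H1.toL2 (A w) =ᵐ[volume.restrict (Icc 0 h)] opF τ s C (V 0 w)

/-- `𝓕 V⁻`, with `V⁻ φ = V(φ,0)`, is a bounded operator from `L²([-τ,0])` to `H¹([0,h])`. -/
def HypMinus {d : ℕ} (τ s h : ℝ) (C : ℝ → ℝ → Matrix (Fin d) (Fin d) ℝ) : Prop :=
  ∃ A : L2 d (-τ) 0 →L[ℝ] H1 d 0 h, ∀ φ : L2 d (-τ) 0,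
    H1.toL2 (A φ) =ᵐ[volume.restrict (Icc 0 h)] opF τ s C (V φ 0)

/-- The Legendre polynomial of degree `N` on `[0,h]`. -/
def legendre (h : ℝ) (N : ℕ) : Polynomial ℝ :=
  ((Polynomial.shiftedLegendre N).map (Int.castRingHom ℝ)).comp
    (Polynomial.C h⁻¹ * Polynomial.X)

/-- The collocation nodes: the zeros of the Legendre polynomial of degree `N` on `[0,h]`. -/
def nodes (h : ℝ) (N : ℕ) : Finset ℝ := (legendre h N).roots.toFinset

/-- `𝓛_N u = ∑_i ℓ_i u(θ_i)`, the Lagrange interpolant of `u` at the nodes `θ_i`. -/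
def lagrangeInterp {d : ℕ} (h : ℝ) (N : ℕ) (u : ℝ → Vec d) (t : ℝ) : Vec d :=
  ∑ θ ∈ nodes h N, (Lagrange.basis (nodes h N) id θ).eval t • u θ

/-- `w ∈ L²([0,h])` solves `w = 𝓛_N 𝓕 V(φ,w)`. As usual for elements of `H¹`, point values of
`𝓕 V(φ,w)` are those of its continuous representative `u` on `[0,h]`. -/
def IsCollocationSolution {d : ℕ} (τ s h : ℝ) (C : ℝ → ℝ → Matrix (Fin d) (Fin d) ℝ) (N : ℕ)
    (φ : L2 d (-τ) 0) (w : L2 d 0 h) : Prop :=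
  ∃ u : ℝ → Vec d, ContinuousOn u (Icc 0 h) ∧
    u =ᵐ[volume.restrict (Icc 0 h)] opF τ s C (V φ w) ∧
    w =ᵐ[volume.restrict (Icc 0 h)] lagrangeInterp h N u

/-- `T_N φ = V(φ, w*_N)_h`, where `w*_N` solves `w = 𝓛_N 𝓕 V(φ,w)`. -/
def IsCollocationOperator {d : ℕ} (τ s h : ℝ) (C : ℝ → ℝ → Matrix (Fin d) (Fin d) ℝ) (N : ℕ)
    (T : L2 d (-τ) 0 →L[ℝ] L2 d (-τ) 0) : Prop :=
  ∀ (φ : L2 d (-τ) 0) (w : L2 d 0 h), IsCollocationSolution τ s h C N φ w →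
    T φ =ᵐ[volume.restrict (Icc (-τ) 0)] fun θ => V φ w (h + θ)

end RenewalEq

end

/-! Everything reduces to perturbing one invertible operator. Let `Ap`, `Am` be the bounded
operators into `H¹` given by (H2) and (H3), and let `J : H¹ → L²` be the embedding. By linearity of
`opF`, the restriction `w` of a solution to `[0,h]`, with time origin moved to `s`, satisfies `w = J
Ap w + J Am φ`, while collocation solves `w = L_N Ap w + L_N Am φ`, where `L_N : H¹ → L²` is
interpolation.

The exact operator `K = J Ap` is of Volterra type: `|K w(t)| ≤ M ∫₀ᵗ |w|`. Its powers decay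
factorially, so `1 - K` is invertible (`isUnit_one_sub_volterra`). This already gives existence,
uniqueness and a bounded solution map.

The analytic core is `L_N → J` in operator norm (`exists_interpolation_operators`). The cardinal
polynomials at Legendre nodes are orthogonal and their squared `L²` norms sum to `h`, so
interpolation is bounded from the sup norm to `L²` uniformly in `N`
(`integral_norm_sq_lagrangeInterp_le`). Elements of `H¹` are `1/2`-Hölder
(`exists_holder_representative`), so Bernstein polynomials approximate them uniformly at rate
`n^(-1/4)` (`exists_polynomial_approx`). As interpolation reproduces these polynomials, stability
turns this into an `L²` error bound proportional to the `H¹` norm. The slow rate suffices.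

Hence `1 - L_N Ap → 1 - K` in norm. Units are open and inversion is continuous on them, so the
collocation equations are eventually uniquely solvable and `(1 - L_N Ap)⁻¹ L_N Am → (1 - K)⁻¹ J Am`.
Since `τ ≤ h`, the final state is a bounded restriction of `w` alone, and composing with it
preserves norm convergence. -/

namespace RenewalEq

/-! ### Legendre polynomials: orthogonality, zeros, and the cardinal functions at the zeros. -/

section Legendre

open Polynomial

lemma intervalIntegrable_eval (p : ℝ[X]) (a b : ℝ) :
    IntervalIntegrable (fun x => p.eval x) volume a b :=
  p.continuous.intervalIntegrable _ _

/-- Repeated integration by parts: `hf` removes every boundary term, and each step passes one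
derivative to `q`. -/
lemma integral_iterate_derivative_mul (n : ℕ) (f q : ℝ[X])
    (hf : ∀ j < n, (derivative^[j] f).eval 0 = 0 ∧ (derivative^[j] f).eval 1 = 0) :
    ∫ x in (0 : ℝ)..1, (derivative^[n] f * q).eval x =
      (-1) ^ n * ∫ x in (0 : ℝ)..1, (f * derivative^[n] q).eval x := by
  induction n generalizing q with
  | zero => simp
  | succ n ih =>
    have hparts := intervalIntegral.integral_deriv_mul_eq_sub
      (u := fun x => (derivative^[n] f).eval x) (v := fun x => q.eval x)
      (u' := fun x => (derivative^[n + 1] f).eval x) (v' := fun x => (derivative q).eval x)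
      (a := 0) (b := 1)
      (fun x _ => by
        rw [Function.iterate_succ_apply']; exact (derivative^[n] f).hasDerivAt x)
      (fun x _ => q.hasDerivAt x)
      (intervalIntegrable_eval _ _ _) (intervalIntegrable_eval _ _ _)
    have ih' := ih (derivative q) (fun j hj => hf j (by omega))
    obtain ⟨h0, h1⟩ := hf n (by omega)
    simp only [h0, h1, zero_mul, sub_zero] at hparts
    have hsum : ∀ x, eval x (derivative^[n + 1] f) * eval x q
        + eval x (derivative^[n] f) * eval x (derivative q)
        = (derivative^[n + 1] f * q).eval x + (derivative^[n] f * derivative q).eval x := by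
      intro x; simp
    simp_rw [hsum] at hparts
    rw [intervalIntegral.integral_add (intervalIntegrable_eval _ _ _)
      (intervalIntegrable_eval _ _ _), ih'] at hparts
    rw [Function.iterate_succ_apply (f := derivative) (n := n) (x := q), pow_succ]
    linarith

lemma integral_eval_pos {p : ℝ[X]} (hp : p ≠ 0) (h0 : ∀ x ∈ Ioo (0 : ℝ) 1, 0 ≤ p.eval x) :
    0 < ∫ x in (0 : ℝ)..1, p.eval x := by
  obtain ⟨x, hx, hpx⟩ : ∃ x ∈ Ioo (0 : ℝ) 1, p.eval x ≠ 0 := by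
    by_contra! hcon
    exact hp (p.eq_zero_of_infinite_isRoot ((Ioo_infinite one_pos).mono fun x hx => hcon x hx))
  refine (intervalIntegral.integral_pos_iff_support_of_nonneg_ae' ?_
    (intervalIntegrable_eval _ _ _)).2 ⟨one_pos, ?_⟩
  · rw [uIoc_of_le zero_le_one, ← restrict_Ioo_eq_restrict_Ioc]
    exact (ae_restrict_iff' measurableSet_Ioo).2 (Eventually.of_forall h0)
  · have ho : IsOpen (Function.support (fun x => p.eval x) ∩ Ioo 0 1) :=
      (isOpen_ne_fun p.continuous continuous_const).inter isOpen_Ioo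
    exact (ho.measure_pos volume ⟨x, hpx, hx⟩).trans_le
      (measure_mono (inter_subset_inter_right _ Ioo_subset_Ioc_self))

/-- The shifted Legendre polynomial as a real polynomial. -/
noncomputable def realShiftedLegendre (N : ℕ) : ℝ[X] :=
  (shiftedLegendre N).map (Int.castRingHom ℝ)

lemma rodrigues (N : ℕ) :
    C (N.factorial : ℝ) * realShiftedLegendre N = derivative^[N] (X ^ N * (1 - X) ^ N) := by
  have h := congrArg (Polynomial.map (Int.castRingHom ℝ)) (factorial_mul_shiftedLegendre_eq N)
  rw [← Polynomial.iterate_derivative_map] at h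
  simpa [realShiftedLegendre] using h

lemma realShiftedLegendre_natDegree (N : ℕ) : (realShiftedLegendre N).natDegree = N := by
  rw [realShiftedLegendre, natDegree_map_eq_of_injective (RingHom.injective_int _),
    natDegree_shiftedLegendre]

lemma realShiftedLegendre_ne_zero (N : ℕ) : realShiftedLegendre N ≠ 0 := by
  rw [realShiftedLegendre, Ne, Polynomial.map_eq_zero_iff (RingHom.injective_int _)]
  intro h
  have := degree_shiftedLegendre N
  simp [h] at this

lemma eval_iterate_derivative_of_dvd {p q : ℝ[X]} {N j : ℕ} (r : ℝ) (hj : j < N)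
    (h : p = (X - C r) ^ N * q) : (derivative^[j] p).eval r = 0 := by
  have := Polynomial.pow_sub_dvd_iterate_derivative_of_pow_dvd j (Dvd.intro q h.symm)
  exact dvd_iff_isRoot.1 ((dvd_pow_self _ (by omega)).trans this)

/-- In the Rodrigues formula `X^N (1 - X)^N` vanishes to order `N` at both endpoints, so all `N`
derivatives can be moved onto `q`, which they annihilate. -/
lemma integral_realShiftedLegendre_mul {N : ℕ} {q : ℝ[X]} (hq : q.degree < N) :
    ∫ x in (0 : ℝ)..1, (realShiftedLegendre N * q).eval x = 0 := by
  have h := integral_iterate_derivative_mul N (X ^ N * (1 - X) ^ N) q (fun j hj =>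
    ⟨eval_iterate_derivative_of_dvd (q := (1 - X) ^ N) 0 hj (by simp),
      eval_iterate_derivative_of_dvd (q := (-1) ^ N * X ^ N) 1 hj (by
        rw [← mul_assoc, ← mul_pow, ← mul_pow, ← mul_pow, C_1]; congr 1; ring)⟩)
  rw [iterate_derivative_eq_zero_of_degree_lt hq, ← rodrigues] at h
  simp only [mul_zero, eval_zero, intervalIntegral.integral_zero, mul_assoc, eval_mul (p := C _),
    eval_C, intervalIntegral.integral_const_mul] at h
  exact (mul_eq_zero.1 h).resolve_left (by positivity)

lemma card_roots_le_iterate_derivative (p : ℝ[X]) (k : ℕ) :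
    Multiset.card p.roots ≤ Multiset.card (derivative^[k] p).roots + k := by
  induction k with
  | zero => simp
  | succ k ih =>
    rw [Function.iterate_succ_apply']
    have := card_roots_le_derivative (derivative^[k] p)
    omega

/-- Rolle's theorem: `X^N (1 - X)^N` has `2N` real roots with multiplicity, and each differentiation
loses at most one, so at least `N` survive. -/
lemma card_roots_realShiftedLegendre (N : ℕ) :
    Multiset.card (realShiftedLegendre N).roots = N := by
  refine le_antisymm ((card_roots' _).trans (realShiftedLegendre_natDegree N).le) ?_
  have h := card_roots_le_iterate_derivative (X ^ N * (1 - X) ^ N) N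
  rw [← rodrigues, roots_C_mul _ (by positivity)] at h
  have h1 : (1 - X : ℝ[X]) ≠ 0 := by
    rw [← neg_sub]; exact neg_ne_zero.2 (X_sub_C_ne_zero 1)
  have h2 : (1 - X : ℝ[X]).roots = {1} := by
    rw [← neg_sub, roots_neg]; exact roots_X_sub_C 1
  rw [roots_mul (mul_ne_zero (pow_ne_zero _ X_ne_zero) (pow_ne_zero _ h1)), roots_pow, roots_pow,
    roots_X, h2] at h
  simp at h
  omega

/-- Factor out `X - r` with quotient `g`. If `r` lay outside the interval, the product of the
Legendre polynomial with `g` would be `(x - r) g²`, of constant sign, although orthogonality makes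
its integral zero. -/
lemma mem_Ioo_of_isRoot_realShiftedLegendre {N : ℕ} {r : ℝ} (hr : (realShiftedLegendre N).IsRoot r) :
    r ∈ Ioo (0 : ℝ) 1 := by
  obtain ⟨g, hg⟩ := dvd_iff_isRoot.2 hr
  have hne := realShiftedLegendre_ne_zero N
  have hg0 : g ≠ 0 := by rintro rfl; simp [hg] at hne
  have hdeg : g.degree < N := by
    have := realShiftedLegendre_natDegree N
    rw [hg, natDegree_mul (X_sub_C_ne_zero r) hg0, natDegree_X_sub_C] at this
    rw [degree_eq_natDegree hg0]; exact_mod_cast (by omega)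
  have hint := integral_realShiftedLegendre_mul hdeg
  have hne' : realShiftedLegendre N * g ≠ 0 := mul_ne_zero hne hg0
  have heval : ∀ x, (realShiftedLegendre N * g).eval x = (x - r) * (g.eval x) ^ 2 := by
    intro x; rw [hg]; simp; ring
  constructor
  · by_contra! hr0
    refine (integral_eval_pos hne' fun x hx => ?_).ne' hint
    rw [heval]
    exact mul_nonneg (by linarith [hx.1]) (sq_nonneg _)
  · by_contra! hr0
    have := integral_eval_pos (neg_ne_zero.2 hne') fun x hx => ?_
    · simp only [eval_neg, intervalIntegral.integral_neg, hint] at this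
      simp at this
    · rw [eval_neg, heval, ← neg_mul]
      exact mul_nonneg (by linarith [hx.2]) (sq_nonneg _)

/-- A double root `r` with cofactor `g` would make the product with `g` equal to `((x - r) g)²`,
again contradicting orthogonality. -/
lemma nodup_roots_realShiftedLegendre (N : ℕ) : (realShiftedLegendre N).roots.Nodup := by
  rw [Multiset.nodup_iff_count_le_one]
  intro r
  rw [count_roots]
  by_contra! hr
  obtain ⟨g, hg⟩ := (le_rootMultiplicity_iff (realShiftedLegendre_ne_zero N)).1
    (Nat.succ_le_of_lt hr)
  have hne := realShiftedLegendre_ne_zero N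
  have hg0 : g ≠ 0 := by rintro rfl; simp [hg] at hne
  have hdeg : g.degree < N := by
    have := realShiftedLegendre_natDegree N
    rw [hg, natDegree_mul (pow_ne_zero _ (X_sub_C_ne_zero r)) hg0, natDegree_pow,
      natDegree_X_sub_C] at this
    rw [degree_eq_natDegree hg0]; exact_mod_cast (by omega)
  refine (integral_eval_pos (mul_ne_zero hne hg0) fun x hx => ?_).ne'
    (integral_realShiftedLegendre_mul hdeg)
  rw [hg]
  simp only [eval_mul, eval_pow, eval_sub, eval_X, eval_C]
  have : (x - r) ^ (1).succ * eval x g * eval x g = ((x - r) * eval x g) ^ 2 := by ring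
  rw [this]; positivity

lemma legendre_eq (h : ℝ) (N : ℕ) :
    legendre h N = (realShiftedLegendre N).comp (C h⁻¹ * X) := rfl

lemma eval_legendre (h : ℝ) (N : ℕ) (x : ℝ) :
    (legendre h N).eval x = (realShiftedLegendre N).eval (h⁻¹ * x) := by
  simp [legendre_eq]

lemma natDegree_legendre {h : ℝ} (hh : 0 < h) (N : ℕ) : (legendre h N).natDegree = N := by
  rw [legendre_eq, natDegree_comp, natDegree_C_mul_X _ (inv_ne_zero hh.ne'),
    realShiftedLegendre_natDegree, mul_one]

lemma legendre_ne_zero {h : ℝ} (hh : 0 < h) (N : ℕ) : legendre h N ≠ 0 := by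
  intro h0
  refine realShiftedLegendre_ne_zero N (Polynomial.funext fun x => ?_)
  have := eval_legendre h N (h * x)
  rw [← mul_assoc, inv_mul_cancel₀ hh.ne', one_mul, h0] at this
  simpa using this.symm

lemma nodes_eq_image {h : ℝ} (hh : 0 < h) (N : ℕ) :
    nodes h N = (realShiftedLegendre N).roots.toFinset.image (h * ·) := by
  ext x
  simp only [nodes, Multiset.mem_toFinset, Finset.mem_image, mem_roots (legendre_ne_zero hh N),
    mem_roots (realShiftedLegendre_ne_zero N), IsRoot, eval_legendre]
  constructor
  · exact fun hx => ⟨h⁻¹ * x, hx, by field_simp⟩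
  · rintro ⟨y, hy, rfl⟩
    rwa [← mul_assoc, inv_mul_cancel₀ hh.ne', one_mul]

lemma card_nodes {h : ℝ} (hh : 0 < h) (N : ℕ) : (nodes h N).card = N := by
  rw [nodes_eq_image hh, Finset.card_image_of_injective _ (mul_right_injective₀ hh.ne'),
    Multiset.toFinset_card_of_nodup (nodup_roots_realShiftedLegendre N),
    card_roots_realShiftedLegendre]

lemma mem_Ioo_of_mem_nodes {h : ℝ} (hh : 0 < h) {N : ℕ} {x : ℝ} (hx : x ∈ nodes h N) :
    x ∈ Ioo 0 h := by
  rw [nodes_eq_image hh] at hx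
  obtain ⟨y, hy, rfl⟩ := Finset.mem_image.1 hx
  have := mem_Ioo_of_isRoot_realShiftedLegendre (isRoot_of_mem_roots (Multiset.mem_toFinset.1 hy))
  exact ⟨mul_pos hh this.1, by nlinarith [this.2]⟩

lemma integral_legendre_mul {h : ℝ} (hh : 0 < h) {N : ℕ} {q : ℝ[X]} (hq : q.degree < N) :
    ∫ x in (0 : ℝ)..h, (legendre h N * q).eval x = 0 := by
  have hdeg : (q.comp (C h * X)).degree < N := by
    by_cases h0 : q.comp (C h * X) = 0
    · rw [h0, degree_zero]; exact WithBot.bot_lt_coe N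
    · have hq0 : q ≠ 0 := by rintro rfl; simp at h0
      rw [degree_eq_natDegree h0, natDegree_comp, natDegree_C_mul_X _ hh.ne', mul_one,
        ← degree_eq_natDegree hq0]
      exact hq
  have h1 := integral_realShiftedLegendre_mul hdeg
  have h2 := intervalIntegral.mul_integral_comp_mul_left (a := 0) (b := 1)
    (f := fun x => (legendre h N * q).eval x) h
  simp only [mul_zero, mul_one] at h2
  rw [← h2]
  refine mul_eq_zero_of_right _ (Eq.trans ?_ h1)
  congr 1; ext x
  simp [eval_legendre, ← mul_assoc, inv_mul_cancel₀ hh.ne']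

/-- The cardinal Lagrange polynomials at the Legendre nodes. -/
noncomputable abbrev ell (h : ℝ) (N : ℕ) (θ : ℝ) : ℝ[X] := Lagrange.basis (nodes h N) id θ

/-- The product vanishes at all nodes, hence is divisible by the Legendre polynomial. The quotient
has degree `2(N - 1) - N < N`, so orthogonality applies. -/
lemma integral_ell_mul_ell {h : ℝ} (hh : 0 < h) {N : ℕ} {i j : ℝ} (hi : i ∈ nodes h N)
    (hj : j ∈ nodes h N) (hij : i ≠ j) :
    ∫ x in (0 : ℝ)..h, (ell h N i * ell h N j).eval x = 0 := by
  have hinj : Set.InjOn (id : ℝ → ℝ) (nodes h N) := injOn_id _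
  have hN : 0 < N := by rw [← card_nodes hh N]; exact Finset.card_pos.2 ⟨i, hi⟩
  have hdeg : ∀ k ∈ nodes h N, (ell h N k).natDegree = N - 1 := fun k hk => by
    rw [ell, Lagrange.natDegree_basis hinj hk, card_nodes hh]
  have hne : ∀ k ∈ nodes h N, ell h N k ≠ 0 := fun k hk => Lagrange.basis_ne_zero hinj hk
  have hdvd : legendre h N ∣ ell h N i * ell h N j := by
    rw [← EuclideanDomain.mod_eq_zero]
    refine Polynomial.eq_zero_of_degree_lt_of_eval_finset_eq_zero (nodes h N) ?_ ?_
    · rw [card_nodes hh]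
      refine (EuclideanDomain.mod_lt (ell h N i * ell h N j) (legendre_ne_zero hh N)).trans_eq ?_
      rw [degree_eq_natDegree (legendre_ne_zero hh N), natDegree_legendre hh]
    · intro x hx
      have hroot : (legendre h N).eval x = 0 := isRoot_of_mem_roots (Multiset.mem_toFinset.1 hx)
      have := congrArg (eval x) (EuclideanDomain.div_add_mod (ell h N i * ell h N j) (legendre h N))
      rw [eval_add, eval_mul, hroot, zero_mul, zero_add, eval_mul] at this
      rw [this]
      by_cases hxi : i = x
      · subst hxi
        exact mul_eq_zero_of_right _ (Lagrange.eval_basis_of_ne (v := id) hij.symm hx)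
      · exact mul_eq_zero_of_left (Lagrange.eval_basis_of_ne (v := id) hxi hx) _
  obtain ⟨q, hq⟩ := hdvd
  have hq0 : q ≠ 0 := by
    rintro rfl
    rw [mul_zero] at hq
    exact mul_ne_zero (hne i hi) (hne j hj) hq
  rw [hq]
  refine integral_legendre_mul hh ?_
  have := congrArg natDegree hq
  rw [natDegree_mul (hne i hi) (hne j hj), natDegree_mul (legendre_ne_zero hh N) hq0, hdeg i hi,
    hdeg j hj, natDegree_legendre hh] at this
  rw [degree_eq_natDegree hq0]
  exact_mod_cast (by omega)

/-- Since the `ell` sum to `1` and are orthogonal, `∫ ℓᵢ² = ∫ ℓᵢ`; summing over `i` gives `∫ 1 = h`.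
-/
lemma sum_integral_ell_sq {h : ℝ} (hh : 0 < h) {N : ℕ} (hN : 0 < N) :
    ∑ i ∈ nodes h N, ∫ x in (0 : ℝ)..h, (ell h N i * ell h N i).eval x = h := by
  have h1 : ∀ i ∈ nodes h N, ∫ x in (0 : ℝ)..h, (ell h N i * ell h N i).eval x
      = ∫ x in (0 : ℝ)..h, (ell h N i).eval x := by
    intro i hi
    have hsum : ∑ j ∈ nodes h N, ell h N j = 1 :=
      Lagrange.sum_basis (injOn_id _) (Finset.card_pos.1 (by rwa [card_nodes hh]))
    have : ell h N i = ∑ j ∈ nodes h N, ell h N i * ell h N j := by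
      rw [← Finset.mul_sum, hsum, mul_one]
    conv_rhs => rw [this]
    simp_rw [eval_finsetSum]
    rw [intervalIntegral.integral_finsetSum fun j _ => intervalIntegrable_eval _ _ _,
      Finset.sum_eq_single i (fun j hj hji => integral_ell_mul_ell hh hi hj hji.symm)
        (fun hi' => absurd hi hi')]
  rw [Finset.sum_congr rfl h1, ← intervalIntegral.integral_finsetSum
    fun j _ => intervalIntegrable_eval _ _ _]
  simp_rw [← eval_finsetSum]
  rw [Lagrange.sum_basis (injOn_id _) (Finset.card_pos.1 (by rwa [card_nodes hh]))]
  simp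

end Legendre

/-! ### Stability and `L²` error of interpolation at the Legendre nodes. -/

section Interpolation

open Polynomial

variable {d : ℕ}

lemma continuous_lagrangeInterp (h : ℝ) (N : ℕ) (u : ℝ → Vec d) :
    Continuous (lagrangeInterp h N u) := by
  unfold lagrangeInterp
  exact continuous_finsetSum _ fun i _ => (Polynomial.continuous _).smul continuous_const

lemma lagrangeInterp_add (h : ℝ) (N : ℕ) (u v : ℝ → Vec d) (t : ℝ) :
    lagrangeInterp h N (u + v) t = lagrangeInterp h N u t + lagrangeInterp h N v t := by
  simp [lagrangeInterp, Finset.sum_add_distrib]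

lemma lagrangeInterp_smul (h : ℝ) (N : ℕ) (c : ℝ) (u : ℝ → Vec d) (t : ℝ) :
    lagrangeInterp h N (c • u) t = c • lagrangeInterp h N u t := by
  simp only [lagrangeInterp, Finset.smul_sum, Pi.smul_apply]
  exact Finset.sum_congr rfl fun i _ => smul_comm _ _ _

lemma lagrangeInterp_sub (h : ℝ) (N : ℕ) (u v : ℝ → Vec d) (t : ℝ) :
    lagrangeInterp h N (u - v) t = lagrangeInterp h N u t - lagrangeInterp h N v t := by
  simp [lagrangeInterp, smul_sub]

lemma lagrangeInterp_congr {h : ℝ} (hh : 0 < h) (N : ℕ) {u v : ℝ → Vec d}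
    (huv : EqOn u v (Icc 0 h)) : lagrangeInterp h N u = lagrangeInterp h N v := by
  ext1 t
  refine Finset.sum_congr rfl fun θ hθ => ?_
  rw [huv (Ioo_subset_Icc_self (mem_Ioo_of_mem_nodes hh hθ))]

lemma norm_sq_lagrangeInterp (h : ℝ) (N : ℕ) (u : ℝ → Vec d) (t : ℝ) :
    ‖lagrangeInterp h N u t‖ ^ 2 = ∑ i ∈ nodes h N, ∑ j ∈ nodes h N,
      (ell h N i * ell h N j).eval t * inner ℝ (u i) (u j) := by
  rw [← real_inner_self_eq_norm_sq, lagrangeInterp, sum_inner]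
  refine Finset.sum_congr rfl fun i _ => ?_
  rw [inner_sum]
  refine Finset.sum_congr rfl fun j _ => ?_
  rw [real_inner_smul_left, real_inner_smul_right, eval_mul, mul_assoc]

/-- Stability of interpolation at the Legendre nodes from the sup norm to `L²`. -/
lemma integral_norm_sq_lagrangeInterp_le {h : ℝ} (hh : 0 < h) {N : ℕ} (hN : 0 < N)
    {u : ℝ → Vec d} {B : ℝ} (hu : ∀ θ ∈ nodes h N, ‖u θ‖ ≤ B) :
    ∫ t in (0 : ℝ)..h, ‖lagrangeInterp h N u t‖ ^ 2 ≤ h * B ^ 2 := by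
  have hint : ∀ i j : ℝ, IntervalIntegrable
      (fun t => (ell h N i * ell h N j).eval t * inner ℝ (u i) (u j)) volume 0 h :=
    fun i j => (intervalIntegrable_eval _ _ _).mul_const _
  have hint' : ∀ i : ℝ, IntervalIntegrable (fun t => ∑ j ∈ nodes h N,
      (ell h N i * ell h N j).eval t * inner ℝ (u i) (u j)) volume 0 h := fun i =>
    (continuous_finsetSum _ fun j _ => (Polynomial.continuous _).mul_const _).intervalIntegrable _ _
  simp_rw [norm_sq_lagrangeInterp]
  rw [intervalIntegral.integral_finsetSum fun i _ => hint' i]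
  simp_rw [intervalIntegral.integral_finsetSum fun j (_ : j ∈ nodes h N) => hint _ j,
    intervalIntegral.integral_mul_const]
  have hdiag : ∀ i ∈ nodes h N,
      ∑ j ∈ nodes h N, (∫ t in (0 : ℝ)..h, (ell h N i * ell h N j).eval t) * inner ℝ (u i) (u j)
        ≤ (∫ t in (0 : ℝ)..h, (ell h N i * ell h N i).eval t) * B ^ 2 := by
    intro i hi
    rw [Finset.sum_eq_single i (fun j hj hji => by
      rw [integral_ell_mul_ell hh hi hj hji.symm, zero_mul]) (fun hi' => absurd hi hi'),
      real_inner_self_eq_norm_sq]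
    have h0 : 0 ≤ ∫ t in (0 : ℝ)..h, (ell h N i * ell h N i).eval t :=
      intervalIntegral.integral_nonneg hh.le fun t _ => by
        rw [eval_mul]; exact mul_self_nonneg _
    gcongr
    exact hu i hi
  refine (Finset.sum_le_sum hdiag).trans_eq ?_
  rw [← Finset.sum_mul, sum_integral_ell_sq hh hN]

lemma lagrangeInterp_polynomial {ι : Type*} {h : ℝ} (hh : 0 < h) {N : ℕ} (S : Finset ι)
    (p : ι → ℝ[X]) (hp : ∀ k ∈ S, (p k).degree < N) (c : ι → Vec d) (t : ℝ) :
    lagrangeInterp h N (fun x => ∑ k ∈ S, (p k).eval x • c k) t = ∑ k ∈ S, (p k).eval t • c k := by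
  simp only [lagrangeInterp, Finset.smul_sum]
  rw [Finset.sum_comm]
  refine Finset.sum_congr rfl fun k hk => ?_
  simp only [smul_smul, ← Finset.sum_smul]
  congr 1
  have := Lagrange.eq_interpolate (s := nodes h N) (v := id) (f := p k) (injOn_id _)
    (by rw [card_nodes hh]; exact hp k hk)
  conv_rhs => rw [this]
  simp [Lagrange.interpolate_apply, eval_finsetSum, mul_comm]

/-- The rate of Bernstein approximation of `1/2`-Hölder functions on `[0,h]`. -/
noncomputable def bernsteinRate (h : ℝ) (n : ℕ) : ℝ := 2 * (√h * √(√(n : ℝ))⁻¹)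

lemma bernsteinRate_nonneg (h : ℝ) (n : ℕ) : 0 ≤ bernsteinRate h n := by
  unfold bernsteinRate; positivity

lemma tendsto_bernsteinRate (h : ℝ) : Tendsto (bernsteinRate h) atTop (𝓝 0) := by
  have h1 : Tendsto (fun n : ℕ => (√(n : ℝ))⁻¹) atTop (𝓝 0) :=
    tendsto_inv_atTop_zero.comp (Real.tendsto_sqrt_atTop.comp tendsto_natCast_atTop_atTop)
  have h2 := (((Real.continuous_sqrt.tendsto 0).comp h1).const_mul √h).const_mul 2
  rw [Real.sqrt_zero, mul_zero, mul_zero] at h2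
  exact h2

/-- Replaces the Hölder modulus by a quadratic, so that the variance of the Bernstein weights can
control it; `δ` is a free scale. -/
lemma sqrt_le_of_pos {a δ : ℝ} (ha : 0 ≤ a) (hδ : 0 < δ) :
    √a ≤ √δ * (1 + a ^ 2 / δ ^ 2) := by
  have h1 : √a = √δ * √(a / δ) := by
    rw [← Real.sqrt_mul hδ.le]; congr 1; field_simp
  rw [h1, ← div_pow]
  gcongr
  set b := a / δ
  have hb : 0 ≤ b := by positivity
  rw [Real.sqrt_le_left (by positivity)]
  nlinarith [sq_nonneg (b - 1), sq_nonneg (b ^ 2)]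

/-- The Bernstein weights at `y` form a probability distribution with variance `y(1 - y)/n`.
Averaging the Hölder bound, with `δ = n^(-1/2)` in `sqrt_le_of_pos`, costs a factor `1 + y(1 - y) ≤
2`. -/
lemma exists_polynomial_approx {h : ℝ} (hh : 0 < h) {n : ℕ} (hn : n ≠ 0) {u : ℝ → Vec d} {G : ℝ}
    (hG : 0 ≤ G)
    (hu : ∀ x ∈ Icc 0 h, ∀ y ∈ Icc 0 h, ‖u x - u y‖ ≤ G * √|x - y|) :
    ∃ (p : Fin (n + 1) → ℝ[X]) (c : Fin (n + 1) → Vec d), (∀ k, (p k).degree < (n + 1 : ℕ)) ∧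
      ∀ t ∈ Icc 0 h, ‖u t - ∑ k, (p k).eval t • c k‖ ≤ G * bernsteinRate h n := by
  refine ⟨fun k => (bernsteinPolynomial ℝ n k).comp (C h⁻¹ * X),
    fun k => u (h * bernstein.z k), fun k => ?_, fun t ht => ?_⟩
  · refine degree_lt_iff_coeff_zero _ _ |>.2 fun m hm => coeff_eq_zero_of_natDegree_lt ?_
    have h1 : (bernsteinPolynomial ℝ n k).natDegree ≤ n := by
      unfold bernsteinPolynomial
      have hk : (k : ℕ) ≤ n := by omega
      calc _ ≤ (0 + k * 1) + (n - k) * 1 := by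
            refine natDegree_mul_le_of_le (natDegree_mul_le_of_le (by simp) ?_) ?_
            · exact natDegree_pow_le_of_le _ natDegree_X_le
            · refine natDegree_pow_le_of_le _ ?_
              exact (natDegree_sub_le _ _).trans (by simp)
        _ = n := by omega
    rw [natDegree_comp, natDegree_C_mul_X _ (inv_ne_zero hh.ne')]
    omega
  · set y : unitInterval := ⟨h⁻¹ * t, by
      have := ht.1; positivity, by rw [inv_mul_le_iff₀ hh]; linarith [ht.2]⟩ with hy
    have hty : t = h * y := by simp [hy, hh.ne']
    have hev : ∀ k : Fin (n + 1),
        ((bernsteinPolynomial ℝ n k).comp (C h⁻¹ * X)).eval t = bernstein n k y := by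
      intro k
      rw [bernstein_apply]
      simp [bernsteinPolynomial, hy]
    simp_rw [hev]
    have h1 : u t = ∑ k : Fin (n + 1), bernstein n k y • u t := by
      rw [← Finset.sum_smul, bernstein.probability, one_smul]
    have hn0 : (0 : ℝ) < n := by positivity
    set δ : ℝ := (√(n : ℝ))⁻¹ with hδ
    have hδ0 : 0 < δ := by positivity
    have hδ2 : δ ^ 2 = (n : ℝ)⁻¹ := by rw [hδ, inv_pow, Real.sq_sqrt hn0.le]
    have hterm : ∀ k : Fin (n + 1), ‖bernstein n k y • (u t - u (h * bernstein.z k))‖ ≤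
        G * (√h * √δ) * (bernstein n k y + n * ((y - bernstein.z k : ℝ) ^ 2 * bernstein n k y)) := by
      intro k
      have hb : 0 ≤ bernstein n k y := bernstein_nonneg
      rw [norm_smul, Real.norm_of_nonneg hb]
      have hz : h * (bernstein.z k : ℝ) ∈ Icc 0 h := by
        have h0 := (bernstein.z k).2.1
        have h1 := (bernstein.z k).2.2
        exact ⟨by positivity, by nlinarith⟩
      have h2 := hu t ht _ hz
      have h3 : |t - h * (bernstein.z k : ℝ)| = h * |(y : ℝ) - bernstein.z k| := by
        rw [hty, ← mul_sub, abs_mul, abs_of_pos hh]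
      have h4 := sqrt_le_of_pos (abs_nonneg ((y : ℝ) - bernstein.z k)) hδ0
      rw [hδ2, sq_abs, div_inv_eq_mul] at h4
      rw [h3, Real.sqrt_mul hh.le] at h2
      calc bernstein n k y * ‖u t - u (h * bernstein.z k)‖
          ≤ bernstein n k y * (G * (√h * (√δ * (1 + ((y : ℝ) - bernstein.z k) ^ 2 * n)))) := by
            gcongr
            exact h2.trans (by gcongr)
        _ = _ := by ring
    calc ‖u t - ∑ k : Fin (n + 1), bernstein n k y • u (h * bernstein.z k)‖
        = ‖∑ k : Fin (n + 1), bernstein n k y • (u t - u (h * bernstein.z k))‖ := by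
          conv_lhs => rw [h1]
          rw [← Finset.sum_sub_distrib]
          simp_rw [smul_sub]
      _ ≤ ∑ k : Fin (n + 1), G * (√h * √δ) *
            (bernstein n k y + n * ((y - bernstein.z k : ℝ) ^ 2 * bernstein n k y)) :=
          norm_sum_le_of_le _ fun k _ => hterm k
      _ = G * (√h * √δ) * (1 + y * (1 - y)) := by
          rw [← Finset.mul_sum, Finset.sum_add_distrib, bernstein.probability, ← Finset.mul_sum,
            bernstein.variance hn]
          field_simp
      _ ≤ G * (√h * √δ) * 2 := by
          have := y.2.1
          have := y.2.2
          gcongr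
          nlinarith
      _ = G * bernsteinRate h n := by rw [bernsteinRate]; ring

/-- `L²` error of interpolation at the `n + 1` Legendre nodes for `1/2`-Hölder functions. -/
lemma integral_norm_sq_sub_lagrangeInterp_le {h : ℝ} (hh : 0 < h) {n : ℕ} (hn : n ≠ 0)
    {u : ℝ → Vec d} {G : ℝ} (hG : 0 ≤ G) (huc : ContinuousOn u (Icc 0 h))
    (hu : ∀ x ∈ Icc 0 h, ∀ y ∈ Icc 0 h, ‖u x - u y‖ ≤ G * √|x - y|) :
    ∫ t in (0 : ℝ)..h, ‖lagrangeInterp h (n + 1) u t - u t‖ ^ 2 ≤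
      4 * h * (G * bernsteinRate h n) ^ 2 := by
  obtain ⟨p, c, hp, happ⟩ := exists_polynomial_approx hh hn hG hu
  set B := G * bernsteinRate h n
  set q : ℝ → Vec d := fun x => ∑ k, (p k).eval x • c k
  have hqi : ∀ t, lagrangeInterp h (n + 1) q t = q t :=
    fun t => lagrangeInterp_polynomial hh Finset.univ p (fun k _ => hp k) c t
  have hst := integral_norm_sq_lagrangeInterp_le hh n.succ_pos (u := u - q) (B := B)
    fun θ hθ => happ θ (Ioo_subset_Icc_self (mem_Ioo_of_mem_nodes hh hθ))
  -- As `q` is reproduced, the error of `u` equals the error of `u - q`, whose two terms are bounded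
  -- by stability and by `B`.
  have hb : ∀ t ∈ Icc 0 h, ‖lagrangeInterp h (n + 1) u t - u t‖ ^ 2 ≤
      2 * ‖lagrangeInterp h (n + 1) (u - q) t‖ ^ 2 + 2 * B ^ 2 := by
    intro t ht
    have h1 : lagrangeInterp h (n + 1) u t - u t
        = lagrangeInterp h (n + 1) (u - q) t - (u t - q t) := by
      rw [lagrangeInterp_sub, hqi]; abel
    have h2 := norm_sub_le (lagrangeInterp h (n + 1) (u - q) t) (u t - q t)
    have h3 : ‖u t - q t‖ ≤ B := happ t ht
    have h4 := norm_nonneg (u t - q t)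
    rw [h1]
    set α := ‖lagrangeInterp h (n + 1) (u - q) t‖
    calc _ ≤ (α + B) ^ 2 := by gcongr; linarith
      _ ≤ 2 * α ^ 2 + 2 * B ^ 2 := by nlinarith [sq_nonneg (α - B)]
  calc ∫ t in (0 : ℝ)..h, ‖lagrangeInterp h (n + 1) u t - u t‖ ^ 2
      ≤ ∫ t in (0 : ℝ)..h, (2 * ‖lagrangeInterp h (n + 1) (u - q) t‖ ^ 2 + 2 * B ^ 2) := by
        refine intervalIntegral.integral_mono_on hh.le ?_ ?_ hb
        · refine ContinuousOn.intervalIntegrable ?_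
          rw [uIcc_of_le hh.le]
          exact (((continuous_lagrangeInterp h _ u).continuousOn.sub huc).norm).pow 2
        · refine Continuous.intervalIntegrable ?_ _ _
          exact (((continuous_lagrangeInterp h _ _).norm.pow 2).const_mul 2).add continuous_const
    _ = 2 * (∫ t in (0 : ℝ)..h, ‖lagrangeInterp h (n + 1) (u - q) t‖ ^ 2) + h * (2 * B ^ 2) := by
        rw [intervalIntegral.integral_add, intervalIntegral.integral_const_mul]
        · simp; ring
        · refine Continuous.intervalIntegrable ?_ _ _
          exact ((continuous_lagrangeInterp h _ _).norm.pow 2).const_mul 2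
        · exact intervalIntegrable_const
    _ ≤ _ := by nlinarith

end Interpolation

/-! ### Weak derivatives and the Hölder representative of an `H¹` function. -/

section WeakDerivative

lemma exists_primitive_test {a b : ℝ} {ξ : ℝ → ℝ} (hab : a < b) (hξ : ContDiff ℝ ∞ ξ)
    (hsupp : tsupport ξ ⊆ Ioo a b) (hc : HasCompactSupport ξ)
    (hint : ∫ t in a..b, ξ t = 0) :
    ∃ ζ : ℝ → ℝ, ContDiff ℝ ∞ ζ ∧ HasCompactSupport ζ ∧ tsupport ζ ⊆ Ioo a b ∧ deriv ζ = ξ := by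
  -- The midpoint is adjoined only to make the compact set nonempty when `ξ = 0`, so that it has a
  -- least and a greatest element.
  have hmid : (a + b) / 2 ∈ Ioo a b := ⟨by linarith, by linarith⟩
  have hK : IsCompact (insert ((a + b) / 2) (tsupport ξ)) := hc.isCompact.insert _
  have hKs : insert ((a + b) / 2) (tsupport ξ) ⊆ Ioo a b := insert_subset hmid hsupp
  obtain ⟨m, hm, hml⟩ := hK.exists_isLeast (insert_nonempty _ _)
  obtain ⟨M, hM, hMg⟩ := hK.exists_isGreatest (insert_nonempty _ _)
  have hm' := hKs hm
  have hM' := hKs hM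
  have hlow : ∀ t, t < m → ξ t = 0 := fun t ht => image_eq_zero_of_notMem_tsupport fun h =>
    absurd (hml (mem_insert_of_mem _ h)) (by simpa using ht)
  have hhigh : ∀ t, M < t → ξ t = 0 := fun t ht => image_eq_zero_of_notMem_tsupport fun h =>
    absurd (hMg (mem_insert_of_mem _ h)) (by simpa using ht)
  have hcont : Continuous ξ := hξ.continuous
  have hder : ∀ x, HasDerivAt (fun x => ∫ t in a..x, ξ t) (ξ x) x := fun x =>
    intervalIntegral.integral_hasDerivAt_right (hcont.intervalIntegrable _ _)
      (hcont.stronglyMeasurableAtFilter _ _) hcont.continuousAt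
  have hderiv : deriv (fun x => ∫ t in a..x, ξ t) = ξ := funext fun x => (hder x).deriv
  have hts : tsupport (fun x => ∫ t in a..x, ξ t) ⊆ Icc m M := by
    refine closure_minimal (fun x hx => ?_) isClosed_Icc
    by_contra hxm
    refine hx ?_
    rw [mem_Icc, not_and_or, not_le, not_le] at hxm
    rcases hxm with hxm | hxm
    · refine intervalIntegral.integral_zero_ae (Eventually.of_forall fun t ht => hlow t ?_)
      exact ht.2.trans_lt (max_lt hm'.1 hxm)
    · have h1 : ∫ t in b..x, ξ t = 0 :=
        intervalIntegral.integral_zero_ae (Eventually.of_forall fun t ht => hhigh t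
          ((lt_min hM'.2 hxm).trans ht.1))
      change ∫ t in a..x, ξ t = 0
      rw [← intervalIntegral.integral_add_adjacent_intervals (b := b)
        (hcont.intervalIntegrable _ _) (hcont.intervalIntegrable _ _), hint, h1, add_zero]
  refine ⟨fun x => ∫ t in a..x, ξ t, ?_, ?_, ?_, hderiv⟩
  · refine contDiff_infty_iff_deriv.2 ⟨fun x => (hder x).differentiableAt, ?_⟩
    rwa [hderiv]
  · exact HasCompactSupport.of_support_subset_isCompact isCompact_Icc
      ((subset_tsupport _).trans hts)
  · exact hts.trans fun x hx => ⟨hm'.1.trans_le hx.1, hx.2.trans_lt hM'.2⟩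

/-- The lemma of du Bois-Reymond. -/
lemma ae_eq_const_of_integral_deriv_smul_eq_zero {E : Type*} [NormedAddCommGroup E]
    [NormedSpace ℝ E] [CompleteSpace E] {a b : ℝ} (hab : a < b) {k : ℝ → E}
    (hk : IntegrableOn k (Icc a b))
    (h : ∀ η : ℝ → ℝ, ContDiff ℝ ∞ η → HasCompactSupport η → tsupport η ⊆ Ioo a b →
      ∫ t in Icc a b, deriv η t • k t = 0) :
    ∃ c : E, k =ᵐ[volume.restrict (Icc a b)] fun _ => c := by
  let ψ : ContDiffBump ((a + b) / 2) :=
    { rIn := (b - a) / 8, rOut := (b - a) / 4, rIn_pos := by linarith, rIn_lt_rOut := by linarith }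
  have hψd : ContDiff ℝ ∞ (ψ.normed volume) := ψ.contDiff_normed
  have hψc : HasCompactSupport (ψ.normed volume) := ψ.hasCompactSupport_normed
  have hψs : tsupport (ψ.normed volume) ⊆ Ioo a b := by
    rw [ψ.tsupport_normed_eq, Real.closedBall_eq_Icc]
    change Icc ((a + b) / 2 - (b - a) / 4) ((a + b) / 2 + (b - a) / 4) ⊆ Ioo a b
    intro x hx
    exact ⟨by linarith [hx.1], by linarith [hx.2]⟩
  have hψi : ∫ t in a..b, ψ.normed volume t = 1 := by
    rw [intervalIntegral.integral_of_le hab.le, ← ψ.integral_normed (μ := volume)]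
    exact setIntegral_eq_integral_of_forall_compl_eq_zero fun x hx =>
      image_eq_zero_of_notMem_tsupport fun hx' => hx (Ioo_subset_Ioc_self (hψs hx'))
  have hsmul : ∀ ζ : ℝ → ℝ, Continuous ζ → HasCompactSupport ζ →
      Integrable (fun t => ζ t • k t) (volume.restrict (Icc a b)) := by
    intro ζ hζ hζc
    obtain ⟨C, hC⟩ := hζc.exists_bound_of_continuous hζ
    exact hk.bdd_smul C hζ.aestronglyMeasurable (Eventually.of_forall hC)
  refine ⟨∫ t in Icc a b, ψ.normed volume t • k t, ?_⟩
  set c := ∫ t in Icc a b, ψ.normed volume t • k t with hcdef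
  have key : ∀ᵐ x ∂(volume.restrict (Icc a b)), x ∈ Ioo a b → k x - c = 0 := by
    refine isOpen_Ioo.ae_eq_zero_of_integral_contDiff_smul_eq_zero
      ((hk.sub (integrable_const c)).locallyIntegrable.locallyIntegrableOn _) ?_
    intro η hη hηc hηs
    -- Subtracting `I ψ` gives `η` mean zero, which makes it the derivative of a test function, to
    -- which `h` applies.
    set I := ∫ t in a..b, η t with hI
    have hξd : ContDiff ℝ ∞ (fun t => η t - I * ψ.normed volume t) :=
      hη.sub (contDiff_const.mul hψd)
    have hsub : Function.support (fun t => η t - I * ψ.normed volume t) ⊆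
        tsupport η ∪ tsupport (ψ.normed volume) := by
      intro t ht
      by_contra hcon
      rw [mem_union, not_or] at hcon
      exact ht (by simp [image_eq_zero_of_notMem_tsupport hcon.1,
        image_eq_zero_of_notMem_tsupport hcon.2])
    have hcomp : IsCompact (tsupport η ∪ tsupport (ψ.normed volume)) :=
      hηc.isCompact.union hψc.isCompact
    obtain ⟨ζ, h1, h2, h3, h4⟩ := exists_primitive_test hab hξd
      ((closure_minimal hsub hcomp.isClosed).trans (union_subset hηs hψs))
      (HasCompactSupport.of_support_subset_isCompact hcomp hsub) (by
        rw [intervalIntegral.integral_sub (hη.continuous.intervalIntegrable _ _)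
          ((hψd.continuous.intervalIntegrable _ _).const_mul I),
          intervalIntegral.integral_const_mul, hψi, mul_one, ← hI, sub_self])
    have h5 := h ζ h1 h2 h3
    rw [h4] at h5
    simp_rw [sub_smul, mul_smul] at h5
    rw [integral_sub (hsmul _ hη.continuous hηc) ((hsmul _ hψd.continuous hψc).fun_smul I),
      integral_smul, ← hcdef] at h5
    simp_rw [smul_sub]
    rw [integral_sub (hsmul _ hη.continuous hηc)
      ((hη.continuous.integrable_of_hasCompactSupport hηc).restrict.smul_const c),
      integral_smul_const, integral_Icc_eq_integral_Ioc (f := η),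
      ← intervalIntegral.integral_of_le hab.le, ← hI, h5]
  have hIoo : ∀ᵐ x ∂(volume.restrict (Icc a b)), x ∈ Ioo a b := by
    rw [← restrict_Ioo_eq_restrict_Icc]; exact ae_restrict_mem measurableSet_Ioo
  filter_upwards [key, hIoo] with x hx hx'
  exact sub_eq_zero.1 (hx hx')

/-- The primitive of an integrable function is absolutely continuous with a.e. derivative `g`, so
integration by parts holds; `η` vanishes at both endpoints. -/
lemma integral_deriv_mul_primitive {a b : ℝ} (hab : a < b) {g : ℝ → ℝ}
    (hg : IntegrableOn g (Icc a b)) {η : ℝ → ℝ} (hη : ContDiff ℝ ∞ η)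
    (hηs : tsupport η ⊆ Ioo a b) :
    ∫ t in Icc a b, deriv η t * (∫ r in a..t, g r) = - ∫ t in Icc a b, η t * g t := by
  have hgi : IntervalIntegrable g volume a b :=
    (intervalIntegrable_iff_integrableOn_Icc_of_le hab.le).2 hg
  have h1 := (hgi.absolutelyContinuousOnInterval_intervalIntegral
    (c := a) left_mem_uIcc).integral_mul_deriv_eq_deriv_mul
      ((hη.of_le (by simp)).contDiffOn (s := uIcc a b)).absolutelyContinuousOnInterval
  have ha : η a = 0 := image_eq_zero_of_notMem_tsupport fun h => lt_irrefl _ (hηs h).1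
  have hb : η b = 0 := image_eq_zero_of_notMem_tsupport fun h => lt_irrefl _ (hηs h).2
  rw [ha, hb, mul_zero, mul_zero, sub_zero, zero_sub] at h1
  rw [integral_Icc_eq_integral_Ioc, integral_Icc_eq_integral_Ioc,
    ← intervalIntegral.integral_of_le hab.le, ← intervalIntegral.integral_of_le hab.le]
  simp_rw [mul_comm (deriv η _)]
  rw [h1]
  congr 1
  refine intervalIntegral.integral_congr_ae ?_
  filter_upwards [hgi.ae_hasDerivAt_integral] with t ht htm
  rw [(ht (uIoc_subset_uIcc htm) a left_mem_uIcc).deriv, mul_comm]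

lemma continuousOn_primitive_Icc {E : Type*} [NormedAddCommGroup E] [NormedSpace ℝ E] {a b : ℝ}
    (hab : a < b) {g : ℝ → E} (hg : IntegrableOn g (Icc a b)) :
    ContinuousOn (fun t => ∫ r in a..t, g r) (Icc a b) := by
  rw [← uIcc_of_le hab.le] at hg ⊢
  exact intervalIntegral.continuousOn_primitive_interval hg

lemma integral_deriv_smul_primitive {d : ℕ} {a b : ℝ} (hab : a < b) {g : ℝ → Vec d}
    (hg : IntegrableOn g (Icc a b)) {η : ℝ → ℝ} (hη : ContDiff ℝ ∞ η)
    (hηc : HasCompactSupport η) (hηs : tsupport η ⊆ Ioo a b) :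
    ∫ t in Icc a b, deriv η t • (∫ r in a..t, g r) = - ∫ t in Icc a b, η t • g t := by
  have hgi : IntervalIntegrable g volume a b :=
    (intervalIntegrable_iff_integrableOn_Icc_of_le hab.le).2 hg
  have hprim : ContinuousOn (fun t => ∫ r in a..t, g r) (Icc a b) :=
    continuousOn_primitive_Icc hab hg
  have hi1 : IntegrableOn (fun t => deriv η t • (∫ r in a..t, g r)) (Icc a b) :=
    ((hη.continuous_deriv (by simp)).continuousOn.smul hprim).integrableOn_Icc
  have hi2 : IntegrableOn (fun t => η t • g t) (Icc a b) := by
    obtain ⟨C, hC⟩ := hηc.exists_bound_of_continuous hη.continuous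
    exact hg.bdd_smul C hη.continuous.aestronglyMeasurable (Eventually.of_forall hC)
  ext i
  have hgi' : IntegrableOn (fun t => g t i) (Icc a b) :=
    (EuclideanSpace.proj (𝕜 := ℝ) i).integrable_comp hg
  have h1 := integral_deriv_mul_primitive hab hgi' hη hηs
  have e1 := (EuclideanSpace.proj (𝕜 := ℝ) i).integral_comp_comm hi1
  have e2 := (EuclideanSpace.proj (𝕜 := ℝ) i).integral_comp_comm hi2
  simp only [PiLp.proj_apply, PiLp.smul_apply, smul_eq_mul] at e1 e2
  rw [PiLp.neg_apply, ← e1, ← e2, ← h1]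
  refine setIntegral_congr_fun measurableSet_Icc fun t ht => ?_
  have e3 := (EuclideanSpace.proj (𝕜 := ℝ) i).intervalIntegral_comp_comm
    (hgi.mono_set (uIcc_subset_uIcc_left (by rwa [uIcc_of_le hab.le])))
  simp only [PiLp.proj_apply] at e3
  simp only [e3]

lemma norm_sq_L2 {d : ℕ} {a b : ℝ} (f : L2 d a b) : ‖f‖ ^ 2 = ∫ t in Icc a b, ‖f t‖ ^ 2 := by
  rw [← real_inner_self_eq_norm_sq, L2.inner_def]
  simp

/-- Cauchy–Schwarz against the constant `1`; on short intervals it yields the Hölder exponent `1/2`.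
-/
lemma integral_norm_le_of_subset {d : ℕ} {a b : ℝ} (f : L2 d a b) {s : Set ℝ}
    (hsub : s ⊆ Icc a b) :
    ∫ t in s, ‖f t‖ ≤ ‖f‖ * √(volume.real s) := by
  have hmem : MemLp f 2 (volume.restrict s) :=
    (Lp.memLp f).mono_measure (Measure.restrict_mono hsub le_rfl)
  have hfin : volume s ≠ ⊤ := ((measure_mono hsub).trans_lt (by simp)).ne
  have h1 := eLpNorm_le_eLpNorm_mul_rpow_measure_univ (p := 1) (q := 2) (by norm_num) hmem.1
  have h2 : eLpNorm f 2 (volume.restrict s) ≤ eLpNorm f 2 (volume.restrict (Icc a b)) :=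
    eLpNorm_mono_measure f (Measure.restrict_mono hsub le_rfl)
  have h3 : eLpNorm f 1 (volume.restrict s) ≤
      eLpNorm f 2 (volume.restrict (Icc a b)) * volume s ^ ((1 : ℝ) / 2) := by
    refine h1.trans ?_
    rw [Measure.restrict_apply_univ]
    have : 1 / (1 : ℝ≥0∞).toReal - 1 / (2 : ℝ≥0∞).toReal = 1 / 2 := by norm_num
    rw [this]
    gcongr
  rw [integral_norm_eq_lintegral_enorm hmem.1, ← eLpNorm_one_eq_lintegral_enorm, Lp.norm_def,
    Real.sqrt_eq_rpow, measureReal_def, ENNReal.toReal_rpow, ← ENNReal.toReal_mul]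
  exact ENNReal.toReal_mono (ENNReal.mul_ne_top (Lp.eLpNorm_ne_top f)
    (ENNReal.rpow_ne_top_of_nonneg (by norm_num) hfin)) h3

/-- Elements of `H¹` have a continuous, `1/2`-Hölder representative. -/
lemma exists_holder_representative {d : ℕ} {a b : ℝ} (hab : a < b) (p : H1 d a b) :
    ∃ u : ℝ → Vec d, ContinuousOn u (Icc a b) ∧ u =ᵐ[volume.restrict (Icc a b)] H1.toL2 p ∧
      ∀ x ∈ Icc a b, ∀ y ∈ Icc a b, ‖u x - u y‖ ≤ ‖p‖ * √|x - y| := by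
  obtain ⟨p, hp⟩ := p
  set f := p.fst with hf
  set g := p.snd with hg
  have hfi : IntegrableOn f (Icc a b) := (Lp.memLp f).integrable (by norm_num)
  have hgi : IntegrableOn g (Icc a b) := (Lp.memLp g).integrable (by norm_num)
  have hgint : IntervalIntegrable g volume a b :=
    (intervalIntegrable_iff_integrableOn_Icc_of_le hab.le).2 hgi
  have hprim : ContinuousOn (fun t => ∫ r in a..t, g r) (Icc a b) :=
    continuousOn_primitive_Icc hab hgi
  -- `f` minus the primitive of its weak derivative has zero weak derivative, hence is a.e.
  -- constant.
  obtain ⟨c, hc⟩ := ae_eq_const_of_integral_deriv_smul_eq_zero hab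
    (k := fun t => f t - ∫ r in a..t, g r) (hfi.sub hprim.integrableOn_Icc) (by
      intro η h1 h2 h3
      have hcd := h1.continuous_deriv (by simp)
      simp_rw [smul_sub]
      rw [integral_sub (integrable_smul_L2 f hcd h2.deriv)
        ((hcd.continuousOn.fun_smul hprim).integrableOn_Icc),
        integral_deriv_smul_primitive hab hgi h1 h2 h3, hp η h1 h2 h3, sub_self])
  refine ⟨fun t => c + ∫ r in a..t, g r, continuousOn_const.add hprim, ?_, ?_⟩
  · filter_upwards [hc] with t ht
    rw [← ht]
    exact sub_add_cancel _ _
  · intro x hx y hy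
    have hmono : ∀ z ∈ Icc a b, IntervalIntegrable g volume a z := fun z hz =>
      hgint.mono_set (uIcc_subset_uIcc_left (by rwa [uIcc_of_le hab.le]))
    have hgp : ‖g‖ ≤ ‖p‖ := by
      rw [hg, WithLp.prod_norm_eq_of_L2]
      refine Real.le_sqrt_of_sq_le ?_
      have := sq_nonneg ‖p.fst‖
      linarith
    rw [add_sub_add_left_eq_sub, intervalIntegral.integral_interval_sub_left (hmono x hx)
      (hmono y hy)]
    refine (intervalIntegral.norm_integral_le_integral_norm_uIoc).trans ?_
    refine (integral_norm_le_of_subset g ?_).trans ?_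
    · exact uIoc_subset_uIcc.trans (uIcc_subset_Icc hy hx)
    · rw [measureReal_def, Real.volume_uIoc, ENNReal.toReal_ofReal (abs_nonneg _)]
      change _ ≤ ‖p‖ * _
      gcongr

end WeakDerivative

/-! ### Interpolation as a bounded operator from `H¹` to `L²`, and its norm limit. -/

section InterpolationOperator

variable {d : ℕ}

/-- The embedding of `H¹` into `L²`. -/
noncomputable def H1.toL2L (d : ℕ) (a b : ℝ) : H1 d a b →L[ℝ] L2 d a b :=
  LinearMap.mkContinuous
    { toFun := H1.toL2
      map_add' := fun _ _ => rfl
      map_smul' := fun _ _ => rfl } 1 (by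
    intro p
    rw [one_mul]
    change ‖p.1.fst‖ ≤ ‖p.1‖
    rw [WithLp.prod_norm_eq_of_L2]
    refine Real.le_sqrt_of_sq_le ?_
    have := sq_nonneg ‖p.1.snd‖
    linarith)

lemma H1.toL2L_apply {a b : ℝ} (p : H1 d a b) : H1.toL2L d a b p = H1.toL2 p := rfl

lemma memLp_continuousOn_Icc {a b : ℝ} {u : ℝ → Vec d} (hu : ContinuousOn u (Icc a b)) :
    MemLp u 2 (volume.restrict (Icc a b)) := by
  obtain ⟨C, hC⟩ := isCompact_Icc.exists_bound_of_continuousOn hu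
  exact MemLp.of_bound (hu.aestronglyMeasurable measurableSet_Icc) C
    ((ae_restrict_iff' measurableSet_Icc).2 (Eventually.of_forall hC))

/-- The continuous representative of an element of `H¹`. -/
noncomputable def H1.rep {a b : ℝ} (hab : a < b) (p : H1 d a b) : ℝ → Vec d :=
  (exists_holder_representative hab p).choose

lemma H1.rep_continuousOn {a b : ℝ} (hab : a < b) (p : H1 d a b) :
    ContinuousOn (H1.rep hab p) (Icc a b) :=
  (exists_holder_representative hab p).choose_spec.1

lemma H1.rep_ae_eq {a b : ℝ} (hab : a < b) (p : H1 d a b) :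
    (H1.rep hab p) =ᵐ[volume.restrict (Icc a b)] H1.toL2 p :=
  (exists_holder_representative hab p).choose_spec.2.1

lemma H1.norm_rep_sub_le {a b : ℝ} (hab : a < b) (p : H1 d a b) {x y : ℝ} (hx : x ∈ Icc a b)
    (hy : y ∈ Icc a b) : ‖(H1.rep hab p) x - (H1.rep hab p) y‖ ≤ ‖p‖ * √|x - y| :=
  (exists_holder_representative hab p).choose_spec.2.2 x hx y hy

/-- Makes point values at the nodes independent of the chosen continuous representative; linearity
of interpolation on `H¹` rests on this. -/
lemma H1.eqOn_rep {a b : ℝ} (hab : a < b) (p : H1 d a b) {u : ℝ → Vec d}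
    (hu : ContinuousOn u (Icc a b)) (hup : u =ᵐ[volume.restrict (Icc a b)] H1.toL2 p) :
    EqOn u (H1.rep hab p) (Icc a b) :=
  Measure.eqOn_Icc_of_ae_eq volume hab.ne (hup.trans (H1.rep_ae_eq hab p).symm) hu
    (H1.rep_continuousOn hab p)

/-- The interpolation operator from `H¹` to `L²`, as a linear map. -/
noncomputable def interpLinear (d : ℕ) {h : ℝ} (hh : 0 < h) (N : ℕ) : H1 d 0 h →ₗ[ℝ] L2 d 0 h where
  toFun p := (memLp_continuousOn_Icc
    (continuous_lagrangeInterp h N (H1.rep hh p)).continuousOn).toLp _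
  map_add' p q := by
    rw [← MemLp.toLp_add]
    congr 1
    ext1 t
    rw [Pi.add_apply, ← lagrangeInterp_add]
    refine congrFun (lagrangeInterp_congr hh N ?_) t
    refine (H1.eqOn_rep hh (p + q) ((H1.rep_continuousOn hh p).add ((H1.rep_continuousOn hh q))) ?_).symm
    filter_upwards [(H1.rep_ae_eq hh p), (H1.rep_ae_eq hh q), Lp.coeFn_add (H1.toL2 p) (H1.toL2 q)]
      with t h1 h2 h3
    change _ = (H1.toL2 p + H1.toL2 q) t
    rw [h3, Pi.add_apply, Pi.add_apply, h1, h2]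
  map_smul' c p := by
    rw [RingHom.id_apply, ← MemLp.toLp_const_smul]
    congr 1
    ext1 t
    rw [Pi.smul_apply, ← lagrangeInterp_smul]
    refine congrFun (lagrangeInterp_congr hh N ?_) t
    refine (H1.eqOn_rep hh (c • p) ((H1.rep_continuousOn hh p).const_smul c) ?_).symm
    filter_upwards [(H1.rep_ae_eq hh p), Lp.coeFn_smul c (H1.toL2 p)] with t h1 h2
    change _ = (c • H1.toL2 p) t
    rw [h2, Pi.smul_apply, Pi.smul_apply, h1]

lemma interpLinear_ae_eq {h : ℝ} (hh : 0 < h) (N : ℕ) (p : H1 d 0 h) {u : ℝ → Vec d}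
    (hu : ContinuousOn u (Icc 0 h)) (hup : u =ᵐ[volume.restrict (Icc 0 h)] H1.toL2 p) :
    interpLinear d hh N p =ᵐ[volume.restrict (Icc 0 h)] lagrangeInterp h N u := by
  rw [lagrangeInterp_congr hh N (H1.eqOn_rep hh p hu hup)]
  exact (memLp_continuousOn_Icc
    (continuous_lagrangeInterp h N (H1.rep hh p)).continuousOn).coeFn_toLp

lemma norm_interpLinear_sub_le {h : ℝ} (hh : 0 < h) {n : ℕ} (hn : n ≠ 0) (p : H1 d 0 h) :
    ‖interpLinear d hh (n + 1) p - H1.toL2 p‖ ≤ 2 * √h * bernsteinRate h n * ‖p‖ := by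
  have hr := bernsteinRate_nonneg h n
  refine le_of_sq_le_sq ?_ (by positivity)
  have h1 := integral_norm_sq_sub_lagrangeInterp_le hh hn (norm_nonneg p)
    (H1.rep_continuousOn hh p) fun x hx y hy => (H1.norm_rep_sub_le hh p) hx hy
  rw [norm_sq_L2]
  calc ∫ t in Icc 0 h, ‖(interpLinear d hh (n + 1) p - H1.toL2 p : L2 d 0 h) t‖ ^ 2
      = ∫ t in (0 : ℝ)..h, ‖lagrangeInterp h (n + 1) (H1.rep hh p) t - (H1.rep hh p) t‖ ^ 2 := by
        rw [intervalIntegral.integral_of_le hh.le, ← integral_Icc_eq_integral_Ioc]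
        refine integral_congr_ae ?_
        filter_upwards [interpLinear_ae_eq hh (n + 1) p (H1.rep_continuousOn hh p) (H1.rep_ae_eq hh p),
          (H1.rep_ae_eq hh p), Lp.coeFn_sub (interpLinear d hh (n + 1) p) (H1.toL2 p)] with t e1 e2 e3
        rw [e3, Pi.sub_apply, e1, e2]
    _ ≤ 4 * h * (‖p‖ * bernsteinRate h n) ^ 2 := h1
    _ = (2 * √h * bernsteinRate h n * ‖p‖) ^ 2 := by
        have := Real.sq_sqrt hh.le
        calc _ = 4 * (√h ^ 2) * (‖p‖ * bernsteinRate h n) ^ 2 := by rw [this]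
          _ = _ := by ring

lemma exists_interpolation_operators (d : ℕ) {h : ℝ} (hh : 0 < h) :
    ∃ L : ℕ → H1 d 0 h →L[ℝ] L2 d 0 h,
      (∀ N ≥ 2, ∀ (p : H1 d 0 h) (u : ℝ → Vec d), ContinuousOn u (Icc 0 h) →
        u =ᵐ[volume.restrict (Icc 0 h)] H1.toL2 p →
        L N p =ᵐ[volume.restrict (Icc 0 h)] lagrangeInterp h N u) ∧
      Tendsto L atTop (𝓝 (H1.toL2L d 0 h)) := by
  have hb : ∀ n : ℕ, n ≠ 0 → ∀ p : H1 d 0 h, ‖interpLinear d hh (n + 1) p‖ ≤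
      (2 * √h * bernsteinRate h n + ‖H1.toL2L d 0 h‖) * ‖p‖ := by
    intro n hn p
    have h1 := norm_interpLinear_sub_le hh hn p
    have h2 := (H1.toL2L d 0 h).le_opNorm p
    have h3 := norm_le_norm_sub_add (interpLinear d hh (n + 1) p) (H1.toL2 p)
    rw [H1.toL2L_apply] at h2
    linarith
  -- The error bound uses degree `n = N - 1 ≠ 0`, hence the default `0` for `N ≤ 1`. Boundedness
  -- itself comes from the error bound and the embedding.
  let L : ℕ → H1 d 0 h →L[ℝ] L2 d 0 h := fun N =>
    if hN : N - 1 ≠ 0 then (interpLinear d hh (N - 1 + 1)).mkContinuous _ (hb (N - 1) hN) else 0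
  have hL : ∀ N (_ : N ≥ 2) (p : H1 d 0 h), L N p = interpLinear d hh N p := by
    intro N hN p
    have h1 : N - 1 ≠ 0 := by omega
    have h2 : N - 1 + 1 = N := by omega
    simp only [L, dif_pos h1, LinearMap.mkContinuous_apply, h2]
  refine ⟨L, fun N hN p u hu hup => ?_, ?_⟩
  · rw [hL N hN]
    exact interpLinear_ae_eq hh N p hu hup
  · refine (tendsto_iff_norm_sub_tendsto_zero (E := H1 d 0 h →L[ℝ] L2 d 0 h)).2 ?_
    rw [← tendsto_add_atTop_iff_nat 1]
    have hrate := (tendsto_bernsteinRate h).const_mul (2 * √h)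
    rw [mul_zero] at hrate
    refine squeeze_zero' 
      (Eventually.of_forall fun n => norm_nonneg (L (n + 1) - H1.toL2L d 0 h)) ?_ hrate
    filter_upwards [eventually_ge_atTop 1] with n hn
    have hr := bernsteinRate_nonneg h n
    refine ContinuousLinearMap.opNorm_le_bound _ (by positivity) fun p => ?_
    rw [sub_apply, hL (n + 1) (by omega), H1.toL2L_apply]
    exact norm_interpLinear_sub_le hh (by omega) p

end InterpolationOperator

/-! ### Bounded kernels and invertibility of the Volterra part. -/

section Volterra

variable {d : ℕ}

lemma measurePreserving_const_add_Icc (c a b : ℝ) :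
    MeasurePreserving (fun t => c + t) (volume.restrict (Icc a b))
      (volume.restrict (Icc (c + a) (c + b))) := by
  have h := (measurePreserving_add_left volume c).restrict_preimage
    (measurableSet_Icc (a := c + a) (b := c + b))
  simpa using h

lemma measurableEmbedding_const_add (c : ℝ) : MeasurableEmbedding (fun t : ℝ => c + t) :=
  (Homeomorph.addLeft c).measurableEmbedding

lemma norm_toEuclideanLin_le (A : Matrix (Fin d) (Fin d) ℝ) (v : Vec d) :
    ‖A.toEuclideanLin v‖ ≤ (∑ i, ∑ j, |A i j|) * ‖v‖ := by
  rw [← (EuclideanSpace.basisFun (Fin d) ℝ).sum_repr (A.toEuclideanLin v), Finset.sum_mul]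
  refine norm_sum_le_of_le _ fun i _ => ?_
  rw [norm_smul, OrthonormalBasis.norm_eq_one, mul_one, EuclideanSpace.basisFun_repr,
    Matrix.ofLp_toLpLin, Matrix.toLin'_apply, Matrix.mulVec, dotProduct, Finset.sum_mul]
  refine norm_sum_le_of_le _ fun j _ => ?_
  rw [norm_mul, Real.norm_eq_abs]
  gcongr
  exact PiLp.norm_apply_le v j

/-- A measurable matrix kernel on `[-τ,0]` with operator norm essentially bounded by `M`. -/
structure IsBoundedKernel (τ M : ℝ) (c : ℝ → Matrix (Fin d) (Fin d) ℝ) : Prop where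
  bound : ∀ᵐ θ ∂volume.restrict (Icc (-τ) 0), ∀ v : Vec d, ‖(c θ).toEuclideanLin v‖ ≤ M * ‖v‖
  meas : ∀ i j, AEStronglyMeasurable (fun θ => c θ i j) (volume.restrict (Icc (-τ) 0))

lemma IsBoundedKernel.integrable {τ M : ℝ} {c : ℝ → Matrix (Fin d) (Fin d) ℝ}
    (hc : IsBoundedKernel τ M c) {w : ℝ → Vec d} (hw : IntegrableOn w (Icc (-τ) 0)) :
    IntegrableOn (fun θ => (c θ).toEuclideanLin (w θ)) (Icc (-τ) 0) := by
  refine (hw.norm.const_mul M).mono' ?_ (hc.bound.mono fun θ hθ => hθ (w θ))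
  have hsum : (fun θ => (c θ).toEuclideanLin (w θ)) = fun θ =>
      ∑ i, (∑ j, c θ i j * w θ j) • EuclideanSpace.basisFun (Fin d) ℝ i := by
    ext1 θ
    rw [← (EuclideanSpace.basisFun (Fin d) ℝ).sum_repr ((c θ).toEuclideanLin (w θ))]
    simp only [EuclideanSpace.basisFun_repr, Matrix.ofLp_toLpLin, Matrix.toLin'_apply, Matrix.mulVec,
      dotProduct]
  rw [hsum]
  have hwj : ∀ j, AEStronglyMeasurable (fun θ => w θ j) (volume.restrict (Icc (-τ) 0)) :=
    fun j => (EuclideanSpace.proj (𝕜 := ℝ) j).continuous.comp_aestronglyMeasurable hw.1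
  exact Finset.aestronglyMeasurable_fun_sum _ fun i _ => AEStronglyMeasurable.smul_const
    (Finset.aestronglyMeasurable_fun_sum _ fun j _ => (hc.meas i j).mul (hwj j)) _

/-- Fubini slices the joint measurability and essential bounds at almost every `t`. `M` sums the
essential suprema of the entries. -/
lemma exists_isBoundedKernel {τ s h : ℝ} {C : ℝ → ℝ → Matrix (Fin d) (Fin d) ℝ}
    (hC : HypC τ s h C) : ∃ M, 0 ≤ M ∧
      ∀ᵐ t ∂volume.restrict (Icc s (s + h)), IsBoundedKernel τ M (C t) := by
  let m : Fin d → Fin d → ℝ := fun i j => (eLpNormEssSup (fun p : ℝ × ℝ => C p.1 p.2 i j)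
    (volume.restrict (Icc s (s + h) ×ˢ Icc (-τ) 0))).toReal
  refine ⟨∑ i, ∑ j, m i j, Finset.sum_nonneg fun i _ => Finset.sum_nonneg fun j _ =>
    ENNReal.toReal_nonneg, ?_⟩
  have hprod : (volume : Measure (ℝ × ℝ)).restrict (Icc s (s + h) ×ˢ Icc (-τ) 0) =
      (volume.restrict (Icc s (s + h))).prod (volume.restrict (Icc (-τ) 0)) := by
    rw [Measure.prod_restrict]; rfl
  have hbd : ∀ i j, ∀ᵐ p ∂(volume.restrict (Icc s (s + h))).prod (volume.restrict (Icc (-τ) 0)),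
      |C p.1 p.2 i j| ≤ m i j := by
    intro i j
    rw [← hprod]
    have hfin : eLpNormEssSup (fun p : ℝ × ℝ => C p.1 p.2 i j)
        (volume.restrict (Icc s (s + h) ×ˢ Icc (-τ) 0)) ≠ ⊤ := by
      rw [← eLpNorm_exponent_top]; exact (hC i j).eLpNorm_ne_top
    filter_upwards [enorm_ae_le_eLpNormEssSup (fun p : ℝ × ℝ => C p.1 p.2 i j)
      (volume.restrict (Icc s (s + h) ×ˢ Icc (-τ) 0))] with p hp
    rw [← Real.norm_eq_abs, ← toReal_enorm]
    exact ENNReal.toReal_mono hfin hp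
  have hbd' := Measure.ae_ae_of_ae_prod
    (eventually_all.2 fun i => eventually_all.2 fun j => hbd i j)
  have hms : ∀ i j, ∀ᵐ t ∂volume.restrict (Icc s (s + h)),
      AEStronglyMeasurable (fun θ => C t θ i j) (volume.restrict (Icc (-τ) 0)) := by
    intro i j
    have h1 := (hC i j).1
    rw [hprod] at h1
    exact h1.prodMk_left
  filter_upwards [hbd', eventually_all.2 fun i => eventually_all.2 fun j => hms i j] with t h1 h2
  refine ⟨?_, h2⟩
  filter_upwards [h1] with θ hθ v
  refine (norm_toEuclideanLin_le _ v).trans ?_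
  gcongr with i _ j _
  exact hθ i j

lemma V_eq_add (φ w : ℝ → Vec d) : V φ w = fun t => V 0 w t + V φ 0 t := by
  ext1 t
  by_cases ht : 0 < t <;> simp [V, ht]

lemma memLp_V {τ h : ℝ} {φ w : ℝ → Vec d}
    (hφ : MemLp φ 2 (volume.restrict (Icc (-τ) 0))) (hw : MemLp w 2 (volume.restrict (Icc 0 h))) :
    MemLp (V φ w) 2 (volume.restrict (Icc (-τ) h)) := by
  classical
  have hV : V φ w = (Ioi (0 : ℝ)).piecewise w φ := by
    ext1 t
    by_cases ht : 0 < t <;> simp [V, ht]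
  rw [hV]
  refine MemLp.piecewise measurableSet_Ioi (hw.mono_measure ?_) (hφ.mono_measure ?_)
  · rw [Measure.restrict_restrict measurableSet_Ioi]
    exact Measure.restrict_mono_set _ fun x hx => ⟨le_of_lt hx.1, hx.2.2⟩
  · rw [Measure.restrict_restrict measurableSet_Ioi.compl]
    exact Measure.restrict_mono_set _ fun x hx => ⟨hx.2.1, not_lt.1 hx.1⟩

lemma memLp_V_L2 {τ h : ℝ} (φ : L2 d (-τ) 0) (w : L2 d 0 h) :
    MemLp (V φ w) 2 (volume.restrict (Icc (-τ) h)) := memLp_V (Lp.memLp φ) (Lp.memLp w)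

lemma integrableOn_shift {τ h t : ℝ} (ht : t ∈ Icc 0 h) {v : ℝ → Vec d}
    (hv : IntegrableOn v (Icc (-τ) h)) : IntegrableOn (fun θ => v (t + θ)) (Icc (-τ) 0) := by
  refine (measurePreserving_const_add_Icc t (-τ) 0).integrable_comp_emb
    (measurableEmbedding_const_add t) |>.2 (hv.mono_set ?_)
  exact Icc_subset_Icc (by linarith [ht.1]) (by linarith [ht.2])

lemma opF_V_eq_add {τ s h : ℝ} {C : ℝ → ℝ → Matrix (Fin d) (Fin d) ℝ} {M t : ℝ}
    (ht : t ∈ Icc 0 h) (hc : IsBoundedKernel τ M (C (s + t))) (φ : L2 d (-τ) 0) (w : L2 d 0 h) :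
    opF τ s C (V φ w) t = opF τ s C (V 0 w) t + opF τ s C (V φ 0) t := by
  have h1 : IntegrableOn (V 0 w) (Icc (-τ) h) :=
    (memLp_V (τ := τ) (φ := 0) MemLp.zero (Lp.memLp w)).integrable (by norm_num)
  have h2 : IntegrableOn (V φ 0) (Icc (-τ) h) :=
    (memLp_V (w := 0) (Lp.memLp φ) MemLp.zero).integrable (by norm_num)
  rw [V_eq_add φ w, opF, opF, opF, ← integral_add (hc.integrable (integrableOn_shift ht h1))
    (hc.integrable (integrableOn_shift ht h2))]
  simp only [map_add]

/-- The source of causality: the integral runs over `[t - τ, t]`, and `V 0 w` vanishes at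
nonpositive times, so only `[0,t]` contributes. -/
lemma norm_opF_V_zero_le {τ s h : ℝ} {C : ℝ → ℝ → Matrix (Fin d) (Fin d) ℝ} {M t : ℝ}
    (hM : 0 ≤ M) (ht : t ∈ Icc 0 h) (hc : IsBoundedKernel τ M (C (s + t))) (w : L2 d 0 h) :
    ‖opF τ s C (V 0 w) t‖ ≤ M * ∫ r in Icc 0 t, ‖w r‖ := by
  have hw : IntegrableOn w (Icc 0 h) := (Lp.memLp w).integrable (by norm_num)
  have h1 : IntegrableOn (V 0 w) (Icc (-τ) h) :=
    (memLp_V (τ := τ) (φ := 0) MemLp.zero (Lp.memLp w)).integrable (by norm_num)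
  calc ‖opF τ s C (V 0 w) t‖
      ≤ ∫ θ in Icc (-τ) 0, M * ‖V 0 w (t + θ)‖ :=
        norm_integral_le_of_norm_le ((integrableOn_shift ht h1).norm.const_mul M)
          (hc.bound.mono fun θ hθ => hθ _)
    _ = M * ∫ r in Icc (t + -τ) (t + 0), ‖V 0 w r‖ := by
        rw [integral_const_mul]
        congr 1
        exact (measurePreserving_const_add_Icc t (-τ) 0).integral_comp
          (measurableEmbedding_const_add t) fun r => ‖V 0 w r‖
    _ = M * ∫ r in Icc (t + -τ) t ∩ Ioi 0, ‖w r‖ := by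
        rw [add_zero, ← setIntegral_indicator measurableSet_Ioi]
        congr 2
        ext1 r
        by_cases hr : 0 < r <;> simp [V, hr]
    _ ≤ M * ∫ r in Icc 0 t, ‖w r‖ := by
        refine mul_le_mul_of_nonneg_left ?_ hM
        exact setIntegral_mono_set (hw.mono_set (Icc_subset_Icc le_rfl ht.2)).norm
          (Eventually.of_forall fun _ => norm_nonneg _)
          (Eventually.of_forall fun x hx => ⟨le_of_lt hx.2, hx.1.2⟩)

/-- Iterates of a Volterra operator. -/
lemma norm_volterra_pow_le {h M : ℝ} (hM : 0 ≤ M) {K : L2 d 0 h →L[ℝ] L2 d 0 h}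
    (hK : ∀ w, ∀ᵐ t ∂volume.restrict (Icc 0 h), ‖K w t‖ ≤ M * ∫ r in Icc 0 t, ‖w r‖)
    (w : L2 d 0 h) (n : ℕ) :
    ∀ᵐ t ∂volume.restrict (Icc 0 h), ‖(K ^ (n + 1)) w t‖ ≤
      M ^ (n + 1) * (∫ r in Icc 0 h, ‖w r‖) * (t ^ n / n.factorial) := by
  induction n with
  | zero =>
    have hw : IntegrableOn w (Icc 0 h) := (Lp.memLp w).integrable (by norm_num)
    filter_upwards [hK w, ae_restrict_mem measurableSet_Icc] with t ht htm
    simp only [zero_add, pow_one, pow_zero, Nat.factorial_zero, Nat.cast_one, div_one, mul_one]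
    refine ht.trans ?_
    gcongr
    · exact Eventually.of_forall fun _ => norm_nonneg _
    · exact hw.norm
    · exact htm.2
  | succ n ih =>
    have h1 : ∀ᵐ t ∂volume.restrict (Icc 0 h),
        ‖(K ^ (n + 1 + 1)) w t‖ ≤ M * ∫ r in Icc 0 t, ‖(K ^ (n + 1)) w r‖ := by
      rw [pow_succ' K (n + 1)]
      exact hK ((K ^ (n + 1)) w)
    filter_upwards [h1, ae_restrict_mem measurableSet_Icc] with t ht htm
    set W := ∫ r in Icc 0 h, ‖w r‖
    have hsub : Icc 0 t ⊆ Icc 0 h := Icc_subset_Icc le_rfl htm.2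
    have hint : IntegrableOn ((K ^ (n + 1)) w) (Icc 0 h) :=
      (Lp.memLp _).integrable (by norm_num)
    have hcont : Continuous fun r : ℝ => M ^ (n + 1) * W * (r ^ n / n.factorial) := by fun_prop
    calc ‖(K ^ (n + 1 + 1)) w t‖ ≤ M * ∫ r in Icc 0 t, ‖(K ^ (n + 1)) w r‖ := ht
      _ ≤ M * ∫ r in Icc 0 t, M ^ (n + 1) * W * (r ^ n / n.factorial) := by
          refine mul_le_mul_of_nonneg_left ?_ hM
          exact integral_mono_ae (hint.mono_set hsub).norm hcont.integrableOn_Icc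
            (ae_restrict_of_ae_restrict_of_subset hsub ih)
      _ = M ^ (n + 1 + 1) * W * (t ^ (n + 1) / (n + 1).factorial) := by
          rw [integral_Icc_eq_integral_Ioc, ← intervalIntegral.integral_of_le htm.1,
            intervalIntegral.integral_const_mul, intervalIntegral.integral_div, integral_pow,
            Nat.factorial_succ]
          push_cast
          field_simp
          simp
          ring

/-- One `√h` comes from bounding the `L¹` norm of `w` by its `L²` norm, the other from passing from
the pointwise bound back to `L²`. -/
lemma opNorm_volterra_pow_le {h M : ℝ} (hh : 0 < h) (hM : 0 ≤ M) {K : L2 d 0 h →L[ℝ] L2 d 0 h}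
    (hK : ∀ w, ∀ᵐ t ∂volume.restrict (Icc 0 h), ‖K w t‖ ≤ M * ∫ r in Icc 0 t, ‖w r‖) (n : ℕ) :
    ‖K ^ (n + 1)‖ ≤ h * M * ((M * h) ^ n / n.factorial) := by
  refine ContinuousLinearMap.opNorm_le_bound _ (by positivity) fun w => ?_
  set W := ∫ r in Icc 0 h, ‖w r‖ with hWdef
  have hW : W ≤ ‖w‖ * √h := by
    have := integral_norm_le_of_subset w (subset_refl (Icc 0 h))
    simpa [hh.le] using this
  have hW0 : 0 ≤ W := integral_nonneg fun _ => norm_nonneg _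
  set B := M ^ (n + 1) * W * (h ^ n / n.factorial) with hB
  have hB0 : 0 ≤ B := by positivity
  have hpt : ∀ᵐ t ∂volume.restrict (Icc 0 h), ‖(K ^ (n + 1)) w t‖ ^ 2 ≤ B ^ 2 := by
    filter_upwards [norm_volterra_pow_le hM hK w n, ae_restrict_mem measurableSet_Icc]
      with t ht htm
    have h0 := htm.1
    have h1 := htm.2
    gcongr
    refine ht.trans ?_
    rw [hB]
    gcongr
  have hsq : ‖(K ^ (n + 1)) w‖ ^ 2 ≤ (√h * B) ^ 2 := by
    rw [norm_sq_L2, mul_pow, Real.sq_sqrt hh.le]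
    refine (integral_mono_ae ?_ (integrable_const (B ^ 2)) hpt).trans_eq (by simp [hh.le])
    exact (Lp.memLp ((K ^ (n + 1)) w)).integrable_norm_pow (by norm_num)
  calc ‖(K ^ (n + 1)) w‖ ≤ √h * B := le_of_sq_le_sq hsq (by positivity)
    _ ≤ √h * (M ^ (n + 1) * (‖w‖ * √h) * (h ^ n / n.factorial)) := by rw [hB]; gcongr
    _ = (√h * √h) * M * ((M * h) ^ n / n.factorial) * ‖w‖ := by rw [mul_pow, pow_succ]; ring
    _ = h * M * ((M * h) ^ n / n.factorial) * ‖w‖ := by rw [Real.mul_self_sqrt hh.le]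

/-- `K` need not be a contraction, but some power is. The Neumann series inverts `1 - K^(n+1)`,
which is `1 - K` times a commuting geometric sum, so both factors are units. -/
lemma isUnit_one_sub_volterra {h M : ℝ} (hh : 0 < h) (hM : 0 ≤ M) {K : L2 d 0 h →L[ℝ] L2 d 0 h}
    (hK : ∀ w, ∀ᵐ t ∂volume.restrict (Icc 0 h), ‖K w t‖ ≤ M * ∫ r in Icc 0 t, ‖w r‖) :
    IsUnit (1 - K) := by
  have hlim := (FloorSemiring.tendsto_pow_div_factorial_atTop (M * h)).const_mul (h * M)
  rw [mul_zero] at hlim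
  obtain ⟨n, hn⟩ := (hlim.eventually (gt_mem_nhds zero_lt_one)).exists
  have hlt : ‖K ^ (n + 1)‖ < 1 := (opNorm_volterra_pow_le hh hM hK n).trans_lt hn
  have hu : IsUnit (1 - K ^ (n + 1)) := (Units.oneSub _ hlt).isUnit
  rw [← mul_neg_geom_sum] at hu
  refine (Commute.isUnit_mul_iff ?_).1 hu |>.1
  rw [Commute, SemiconjBy, mul_neg_geom_sum, geom_sum_mul_neg]

end Volterra

/-! ### Translation of both problems into affine fixed-point equations in `L²([0,h])`. -/

section Equations

variable {d : ℕ}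

lemma ae_restrict_Icc_const_add_iff (c a b : ℝ) {P : ℝ → Prop} :
    (∀ᵐ t ∂volume.restrict (Icc a b), P (c + t)) ↔
      ∀ᵐ t ∂volume.restrict (Icc (c + a) (c + b)), P t := by
  rw [← (measurePreserving_const_add_Icc c a b).map_eq,
    (measurableEmbedding_const_add c).ae_map_iff]

lemma opF_congr {τ s h t : ℝ} {C : ℝ → ℝ → Matrix (Fin d) (Fin d) ℝ} (ht : t ∈ Icc 0 h)
    {v v' : ℝ → Vec d} (hv : v =ᵐ[volume.restrict (Icc (-τ) h)] v') :
    opF τ s C v t = opF τ s C v' t := by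
  refine integral_congr_ae ?_
  have h1 : ∀ᵐ θ ∂volume.restrict (Icc (-τ) 0), v (t + θ) = v' (t + θ) := by
    rw [ae_restrict_Icc_const_add_iff t (-τ) 0 (P := fun r => v r = v' r)]
    exact ae_restrict_of_ae_restrict_of_subset
      (Icc_subset_Icc (by linarith [ht.1]) (by linarith [ht.2])) hv
  filter_upwards [h1] with θ hθ
  rw [hθ]

lemma V_ae_eq {τ h : ℝ} {φ w y : ℝ → Vec d}
    (hφ : ∀ᵐ t ∂volume.restrict (Icc (-τ) 0), y t = φ t)
    (hw : ∀ᵐ t ∂volume.restrict (Icc 0 h), y t = w t) :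
    V φ w =ᵐ[volume.restrict (Icc (-τ) h)] y := by
  rw [ae_restrict_iff' measurableSet_Icc] at hφ hw
  refine (ae_restrict_iff' measurableSet_Icc).2 ?_
  filter_upwards [hφ, hw] with t h1 h2 ht
  by_cases h0 : 0 < t
  · rw [V, if_pos h0, h2 ⟨h0.le, ht.2⟩]
  · rw [V, if_neg h0, h1 ⟨ht.1, not_lt.1 h0⟩]

lemma V_ae_eq_right (h : ℝ) (φ w : ℝ → Vec d) :
    ∀ᵐ t ∂volume.restrict (Icc 0 h), V φ w t = w t := by
  rw [← restrict_Ioc_eq_restrict_Icc]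
  filter_upwards [ae_restrict_mem measurableSet_Ioc] with t ht
  rw [V, if_pos ht.1]

lemma isSolution_iff {τ s h : ℝ} {C : ℝ → ℝ → Matrix (Fin d) (Fin d) ℝ}
    {φ : L2 d (-τ) 0} {x : L2 d (s - τ) (s + h)} :
    IsSolution τ s h C φ x ↔ (∀ᵐ θ ∂volume.restrict (Icc (-τ) 0), x (s + θ) = φ θ) ∧
      ∀ᵐ t ∂volume.restrict (Icc 0 h), x (s + t) = opF τ s C (fun r => x (s + r)) t := by
  rw [IsSolution, restrict_Ioc_eq_restrict_Icc]
  refine and_congr_right fun _ => ?_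
  have h1 := ae_restrict_Icc_const_add_iff s 0 h
    (P := fun t => x t = ∫ θ in Icc (-τ) 0, (C t θ).toEuclideanLin (x (t + θ)))
  rw [add_zero] at h1
  rw [← h1]
  simp only [opF, add_assoc]

/-- `w ↦ w(c + ·)` as a bounded operator from `L²([a,b])` to `L²([a',b'])`. -/
lemma exists_shift_operator (d : ℕ) {a b a' b' c : ℝ} (ha : a ≤ c + a') (hb : c + b' ≤ b) :
    ∃ R : L2 d a b →L[ℝ] L2 d a' b', ∀ w : L2 d a b,
      R w =ᵐ[volume.restrict (Icc a' b')] fun θ => w (c + θ) := by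
  have hmp := measurePreserving_const_add_Icc c a' b'
  have hle : volume.restrict (Icc (c + a') (c + b')) ≤ volume.restrict (Icc a b) :=
    Measure.restrict_mono_set _ (Icc_subset_Icc ha hb)
  have hmem : ∀ w : L2 d a b, MemLp (fun θ => w (c + θ)) 2 (volume.restrict (Icc a' b')) :=
    fun w => ((Lp.memLp w).mono_measure hle).comp_measurePreserving hmp
  have hae : ∀ {f g : ℝ → Vec d}, f =ᵐ[volume.restrict (Icc a b)] g →
      ∀ᵐ θ ∂volume.restrict (Icc a' b'), f (c + θ) = g (c + θ) := fun {f g} hfg =>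
    (ae_restrict_Icc_const_add_iff c a' b' (P := fun t => f t = g t)).2
      (ae_mono hle hfg)
  let R : L2 d a b →ₗ[ℝ] L2 d a' b' :=
    { toFun := fun w => (hmem w).toLp _
      map_add' := fun w v => by
        rw [← MemLp.toLp_add]
        exact MemLp.toLp_congr _ _ (hae (Lp.coeFn_add w v))
      map_smul' := fun r w => by
        rw [RingHom.id_apply, ← MemLp.toLp_const_smul]
        exact MemLp.toLp_congr _ _ (hae (Lp.coeFn_smul r w)) }
  refine ⟨R.mkContinuous 1 fun w => ?_, fun w => (hmem w).coeFn_toLp⟩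
  rw [one_mul]
  change ‖(hmem w).toLp _‖ ≤ ‖w‖
  rw [Lp.norm_toLp, Lp.norm_def]
  refine ENNReal.toReal_mono (Lp.eLpNorm_ne_top w) ?_
  have h1 := eLpNorm_comp_measurePreserving (p := 2) ((Lp.memLp w).mono_measure hle).1 hmp
  rw [Function.comp_def] at h1
  rw [h1]
  exact eLpNorm_mono_measure _ hle

lemma eq_add_iff_eq_inverse {E : Type*} [NormedAddCommGroup E] [NormedSpace ℝ E]
    {B : E →L[ℝ] E} (hB : IsUnit (1 - B)) (w y : E) :
    w = B w + y ↔ w = Ring.inverse (1 - B) y := by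
  have h1 := Ring.mul_inverse_cancel _ hB
  have h2 := Ring.inverse_mul_cancel _ hB
  constructor
  · intro hw
    have h3 : (1 - B) w = y := by
      change w - B w = y
      rw [sub_eq_iff_eq_add', ← hw]
    rw [← h3, ← mul_apply_eq_comp, h2]
    rfl
  · intro hw
    have h3 : (1 - B) w = y := by
      rw [hw, ← mul_apply_eq_comp, h1]
      rfl
    change w - B w = y at h3
    rw [← h3]; abel

lemma tendsto_clm_comp {α E F G : Type*} {l : Filter α} [NormedAddCommGroup E] [NormedSpace ℝ E]
    [NormedAddCommGroup F] [NormedSpace ℝ F] [NormedAddCommGroup G] [NormedSpace ℝ G]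
    {f : α → F →L[ℝ] G} {g : α → E →L[ℝ] F} {f₀ : F →L[ℝ] G} {g₀ : E →L[ℝ] F}
    (hf : Tendsto f l (𝓝 f₀)) (hg : Tendsto g l (𝓝 g₀)) :
    Tendsto (fun n => (f n).comp (g n)) l (𝓝 (f₀.comp g₀)) :=
  (isBoundedBilinearMap_comp.continuous.tendsto (f₀, g₀)).comp (hf.prodMk_nhds hg)

section Setting

variable {τ s h : ℝ} {C : ℝ → ℝ → Matrix (Fin d) (Fin d) ℝ}
  {Ap : L2 d 0 h →L[ℝ] H1 d 0 h} {Am : L2 d (-τ) 0 →L[ℝ] H1 d 0 h}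

lemma ae_isBoundedKernel_shift {M : ℝ}
    (hM : ∀ᵐ t ∂volume.restrict (Icc s (s + h)), IsBoundedKernel τ M (C t)) :
    ∀ᵐ t ∂volume.restrict (Icc 0 h), IsBoundedKernel τ M (C (s + t)) := by
  rwa [ae_restrict_Icc_const_add_iff s 0 h (P := fun t => IsBoundedKernel τ M (C t)), add_zero]

/-- (H2) and (H3) treat the two pieces separately; boundedness of the kernel makes both integrals
converge, so they may be added. -/
lemma opF_V_ae_eq (hC : HypC τ s h C)
    (hAp : ∀ w : L2 d 0 h, H1.toL2 (Ap w) =ᵐ[volume.restrict (Icc 0 h)] opF τ s C (V 0 w))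
    (hAm : ∀ φ : L2 d (-τ) 0, H1.toL2 (Am φ) =ᵐ[volume.restrict (Icc 0 h)] opF τ s C (V φ 0))
    (φ : L2 d (-τ) 0) (w : L2 d 0 h) :
    opF τ s C (V φ w) =ᵐ[volume.restrict (Icc 0 h)] H1.toL2 (Ap w + Am φ) := by
  obtain ⟨M, -, hM⟩ := exists_isBoundedKernel hC
  filter_upwards [ae_isBoundedKernel_shift hM, ae_restrict_mem measurableSet_Icc, hAp w, hAm φ,
    Lp.coeFn_add (H1.toL2 (Ap w)) (H1.toL2 (Am φ))] with t h1 h2 h3 h4 h5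
  change _ = (H1.toL2 (Ap w) + H1.toL2 (Am φ)) t
  rw [opF_V_eq_add h2 h1, h5, Pi.add_apply, h3, h4]

lemma isUnit_one_sub_toL2L_comp (hh : 0 < h) (hC : HypC τ s h C)
    (hAp : ∀ w : L2 d 0 h, H1.toL2 (Ap w) =ᵐ[volume.restrict (Icc 0 h)] opF τ s C (V 0 w)) :
    IsUnit (1 - (H1.toL2L d 0 h).comp Ap) := by
  obtain ⟨M, hM0, hM⟩ := exists_isBoundedKernel hC
  refine isUnit_one_sub_volterra hh hM0 fun w => ?_
  filter_upwards [ae_isBoundedKernel_shift hM, ae_restrict_mem measurableSet_Icc, hAp w]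
    with t h1 h2 h3
  rw [ContinuousLinearMap.comp_apply, H1.toL2L_apply, h3]
  exact norm_opF_V_zero_le hM0 h2 h1 w

lemma isCollocationSolution_iff (hh : 0 < h) (hC : HypC τ s h C)
    (hAp : ∀ w : L2 d 0 h, H1.toL2 (Ap w) =ᵐ[volume.restrict (Icc 0 h)] opF τ s C (V 0 w))
    (hAm : ∀ φ : L2 d (-τ) 0, H1.toL2 (Am φ) =ᵐ[volume.restrict (Icc 0 h)] opF τ s C (V φ 0))
    {N : ℕ} {L : H1 d 0 h →L[ℝ] L2 d 0 h}
    (hL : ∀ (p : H1 d 0 h) (u : ℝ → Vec d), ContinuousOn u (Icc 0 h) →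
        u =ᵐ[volume.restrict (Icc 0 h)] H1.toL2 p →
        L p =ᵐ[volume.restrict (Icc 0 h)] lagrangeInterp h N u)
    (φ : L2 d (-τ) 0) (w : L2 d 0 h) :
    IsCollocationSolution τ s h C N φ w ↔ w = L.comp Ap w + L.comp Am φ := by
  have hF := opF_V_ae_eq hC hAp hAm φ w
  rw [ContinuousLinearMap.comp_apply, ContinuousLinearMap.comp_apply, ← map_add]
  constructor
  · rintro ⟨u, hu, huF, hw⟩
    exact Lp.ext (hw.trans (hL _ u hu (huF.trans hF)).symm)
  · intro hw
    refine ⟨H1.rep hh (Ap w + Am φ), H1.rep_continuousOn hh _,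
      (H1.rep_ae_eq hh _).trans hF.symm, ?_⟩
    have := hL _ _ (H1.rep_continuousOn hh (Ap w + Am φ)) (H1.rep_ae_eq hh _)
    rwa [← hw] at this

lemma IsSolution.exists_eq (hτ : 0 ≤ τ) (hC : HypC τ s h C)
    (hAp : ∀ w : L2 d 0 h, H1.toL2 (Ap w) =ᵐ[volume.restrict (Icc 0 h)] opF τ s C (V 0 w))
    (hAm : ∀ φ : L2 d (-τ) 0, H1.toL2 (Am φ) =ᵐ[volume.restrict (Icc 0 h)] opF τ s C (V φ 0))
    {φ : L2 d (-τ) 0} {x : L2 d (s - τ) (s + h)} (hx : IsSolution τ s h C φ x) :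
    ∃ w : L2 d 0 h, w = (H1.toL2L d 0 h).comp Ap w + (H1.toL2L d 0 h).comp Am φ ∧
      (∀ᵐ t ∂volume.restrict (Icc 0 h), w t = x (s + t)) ∧
      V φ w =ᵐ[volume.restrict (Icc (-τ) h)] fun t => x (s + t) := by
  obtain ⟨R, hR⟩ := exists_shift_operator d (a := s - τ) (b := s + h) (a' := 0) (b' := h) (c := s)
    (by linarith) le_rfl
  obtain ⟨h1, h2⟩ := isSolution_iff.1 hx
  have hV : V φ (R x) =ᵐ[volume.restrict (Icc (-τ) h)] fun t => x (s + t) :=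
    V_ae_eq h1 ((hR x).mono fun t ht => ht.symm)
  refine ⟨R x, ?_, hR x, hV⟩
  rw [ContinuousLinearMap.comp_apply, ContinuousLinearMap.comp_apply, ← map_add]
  refine Lp.ext ?_
  filter_upwards [hR x, h2, opF_V_ae_eq hC hAp hAm φ (R x), ae_restrict_mem measurableSet_Icc]
    with t e1 e2 e3 e4
  rw [e1, e2, ← opF_congr e4 hV, e3, H1.toL2L_apply]

/-- The solution is `V φ w` translated by `s`; the fixed-point equation is exactly the renewal
equation on `[0,h]`. -/
lemma exists_isSolution (hC : HypC τ s h C)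
    (hAp : ∀ w : L2 d 0 h, H1.toL2 (Ap w) =ᵐ[volume.restrict (Icc 0 h)] opF τ s C (V 0 w))
    (hAm : ∀ φ : L2 d (-τ) 0, H1.toL2 (Am φ) =ᵐ[volume.restrict (Icc 0 h)] opF τ s C (V φ 0))
    (hτ : 0 ≤ τ) (hh : 0 ≤ h) {φ : L2 d (-τ) 0} {w : L2 d 0 h}
    (hw : w = (H1.toL2L d 0 h).comp Ap w + (H1.toL2L d 0 h).comp Am φ) :
    ∃ x : L2 d (s - τ) (s + h), IsSolution τ s h C φ x := by
  have hmem : MemLp (fun t => V φ w (-s + t)) 2 (volume.restrict (Icc (s - τ) (s + h))) := by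
    have hmp := measurePreserving_const_add_Icc (-s) (s - τ) (s + h)
    rw [show -s + (s - τ) = -τ by ring, show -s + (s + h) = h by ring] at hmp
    exact (memLp_V_L2 φ w).comp_measurePreserving hmp
  have hx : (fun t => hmem.toLp _ (s + t)) =ᵐ[volume.restrict (Icc (-τ) h)] V φ w := by
    have h1 := hmem.coeFn_toLp
    have h2 := (ae_restrict_Icc_const_add_iff s (-τ) h
      (P := fun t => hmem.toLp _ t = V φ w (-s + t))).2 (by rwa [← sub_eq_add_neg])
    filter_upwards [h2] with t ht
    rw [ht, neg_add_cancel_left]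
  refine ⟨hmem.toLp _, isSolution_iff.2 ⟨?_, ?_⟩⟩
  · filter_upwards [ae_restrict_of_ae_restrict_of_subset (Icc_subset_Icc le_rfl hh) hx,
      ae_restrict_mem measurableSet_Icc] with θ h1 h2
    rw [h1, V, if_neg (not_lt.2 h2.2)]
  · filter_upwards [ae_restrict_of_ae_restrict_of_subset (Icc_subset_Icc (neg_nonpos.2 hτ) le_rfl) hx,
      ae_restrict_mem measurableSet_Icc, V_ae_eq_right h φ w, opF_V_ae_eq hC hAp hAm φ w]
      with t h1 h2 h3 h4
    rw [h1, opF_congr h2 hx, h3, h4, ← H1.toL2L_apply, map_add]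
    exact congrArg (fun v : L2 d 0 h => v t) hw

/-- Any two solutions have the same `w` on `[0,h]`, by invertibility, and the same history `φ`, so
they agree a.e. -/
lemma existsUnique_isSolution (hh : 0 < h) (hτ : 0 ≤ τ) (hC : HypC τ s h C)
    (hAp : ∀ w : L2 d 0 h, H1.toL2 (Ap w) =ᵐ[volume.restrict (Icc 0 h)] opF τ s C (V 0 w))
    (hAm : ∀ φ : L2 d (-τ) 0, H1.toL2 (Am φ) =ᵐ[volume.restrict (Icc 0 h)] opF τ s C (V φ 0))
    (φ : L2 d (-τ) 0) : ∃! x : L2 d (s - τ) (s + h), IsSolution τ s h C φ x := by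
  have hunit := isUnit_one_sub_toL2L_comp hh hC hAp
  obtain ⟨x, hx⟩ := exists_isSolution hC hAp hAm hτ hh.le
    ((eq_add_iff_eq_inverse hunit _ ((H1.toL2L d 0 h).comp Am φ)).2 rfl)
  refine ⟨x, hx, fun y hy => ?_⟩
  obtain ⟨w, hw, -, hwx⟩ := hx.exists_eq hτ hC hAp hAm
  obtain ⟨v, hv, -, hvy⟩ := hy.exists_eq hτ hC hAp hAm
  rw [eq_add_iff_eq_inverse hunit] at hw hv
  rw [hv, ← hw] at hvy
  have h1 := (ae_restrict_Icc_const_add_iff s (-τ) h (P := fun t => y t = x t)).1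
    (hvy.symm.trans hwx)
  rw [← sub_eq_add_neg] at h1
  exact Lp.ext h1

end Setting

end Equations

end RenewalEq

/-! ### Norm convergence of the collocation operators. -/

theorem mainTheorem3 (d : ℕ) (hd : 0 < d) (τ s h : ℝ) (hτ : 0 < τ) (hh : τ ≤ h)
    (C : ℝ → ℝ → Matrix (Fin d) (Fin d) ℝ)
    (H1 : RenewalEq.HypC τ s h C)
    (H2 : RenewalEq.HypPlus τ s h C)
    (H3 : RenewalEq.HypMinus τ s h C) :
    (∀ φ : RenewalEq.L2 d (-τ) 0, ∃! x : RenewalEq.L2 d (s - τ) (s + h),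
      RenewalEq.IsSolution τ s h C φ x) ∧
    ∃ N₀ : ℕ,
      (∀ N ≥ N₀, ∀ φ : RenewalEq.L2 d (-τ) 0, ∃! w : RenewalEq.L2 d 0 h,
        RenewalEq.IsCollocationSolution τ s h C N φ w) ∧
      ∃ (T : RenewalEq.L2 d (-τ) 0 →L[ℝ] RenewalEq.L2 d (-τ) 0)
        (TN : ℕ → RenewalEq.L2 d (-τ) 0 →L[ℝ] RenewalEq.L2 d (-τ) 0),
        RenewalEq.IsEvolutionOperator τ s h C T ∧
        (∀ N ≥ N₀, RenewalEq.IsCollocationOperator τ s h C N (TN N)) ∧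
        Tendsto (fun N => ‖TN N - T‖) atTop (𝓝 0) := by
  have hh0 : 0 < h := hτ.trans_le hh
  obtain ⟨Ap, hAp⟩ := H2
  obtain ⟨Am, hAm⟩ := H3
  obtain ⟨L, hL, hLlim⟩ := RenewalEq.exists_interpolation_operators d hh0
  -- `τ ≤ h` puts `[h - τ, h]` inside `[0,h]`, so the final state depends on `φ` only through `w`.
  obtain ⟨R, hR⟩ := RenewalEq.exists_shift_operator d (a := 0) (b := h) (a' := -τ) (b' := 0)
    (c := h) (by linarith) (by linarith)
  have hunit := RenewalEq.isUnit_one_sub_toL2L_comp hh0 H1 hAp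
  set J := RenewalEq.H1.toL2L d 0 h
  have hBlim : Tendsto (fun N => 1 - (L N).comp Ap) atTop (𝓝 (1 - J.comp Ap)) :=
    tendsto_const_nhds.sub (RenewalEq.tendsto_clm_comp hLlim tendsto_const_nhds)
  have hinv : Tendsto (fun N => Ring.inverse (1 - (L N).comp Ap)) atTop
      (𝓝 (Ring.inverse (1 - J.comp Ap))) := by
    obtain ⟨U, hU⟩ := hunit
    rw [← hU] at hBlim ⊢
    exact (NormedRing.inverse_continuousAt U).tendsto.comp hBlim
  obtain ⟨N₁, hN₁⟩ := eventually_atTop.1 (hBlim.eventually (Units.isOpen.mem_nhds hunit))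
  -- Past `N₁` the operator `1 - L_N Ap` is a unit; from `2` on `L N` really is interpolation.
  have hcol : ∀ N ≥ max N₁ 2, ∀ (φ : RenewalEq.L2 d (-τ) 0) (w : RenewalEq.L2 d 0 h),
      RenewalEq.IsCollocationSolution τ s h C N φ w ↔
        w = Ring.inverse (1 - (L N).comp Ap) ((L N).comp Am φ) := by
    intro N hN φ w
    rw [RenewalEq.isCollocationSolution_iff hh0 H1 hAp hAm (hL N ((le_max_right _ _).trans hN)),
      RenewalEq.eq_add_iff_eq_inverse (hN₁ N ((le_max_left _ _).trans hN))]
  refine ⟨RenewalEq.existsUnique_isSolution hh0 hτ.le H1 hAp hAm, max N₁ 2, fun N hN φ =>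
    ⟨_, (hcol N hN φ _).2 rfl, fun w hw => (hcol N hN φ w).1 hw⟩,
    R.comp ((Ring.inverse (1 - J.comp Ap)).comp (J.comp Am)),
    -- `Ring.inverse` is total, with value `0` at non-units, so this sequence is defined for all
    -- `N`, including the small ones.
    fun N => R.comp ((Ring.inverse (1 - (L N).comp Ap)).comp ((L N).comp Am)), ?_, ?_, ?_⟩
  · intro φ x hx
    obtain ⟨w, hw, hwx, -⟩ := hx.exists_eq hτ.le H1 hAp hAm
    rw [RenewalEq.eq_add_iff_eq_inverse hunit] at hw
    change R (Ring.inverse (1 - J.comp Ap) (J.comp Am φ)) =ᵐ[_] _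
    rw [← hw]
    have h1 := (RenewalEq.ae_restrict_Icc_const_add_iff h (-τ) 0
      (P := fun t => w t = x (s + t))).2
      (ae_restrict_of_ae_restrict_of_subset (Icc_subset_Icc (by linarith) (by linarith)) hwx)
    filter_upwards [hR w, h1] with θ e1 e2
    rw [e1, e2, add_assoc]
  · intro N hN φ w hw
    rw [hcol N hN] at hw
    change R (Ring.inverse (1 - (L N).comp Ap) ((L N).comp Am φ)) =ᵐ[_] _
    rw [← hw]
    have h1 := (RenewalEq.ae_restrict_Icc_const_add_iff h (-τ) 0
      (P := fun t => RenewalEq.V φ w t = w t)).2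
      (ae_restrict_of_ae_restrict_of_subset (Icc_subset_Icc (by linarith) (by linarith))
        (RenewalEq.V_ae_eq_right h φ w))
    filter_upwards [hR w, h1] with θ e1 e2
    rw [e1, e2]
  · have hlim : Tendsto
        (fun N => R.comp ((Ring.inverse (1 - (L N).comp Ap)).comp ((L N).comp Am))) atTop
        (𝓝 (R.comp ((Ring.inverse (1 - J.comp Ap)).comp (J.comp Am)))) :=
      RenewalEq.tendsto_clm_comp tendsto_const_nhds
        (RenewalEq.tendsto_clm_comp hinv (RenewalEq.tendsto_clm_comp hLlim tendsto_const_nhds))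
    exact tendsto_iff_norm_sub_tendsto_zero.1 hlim
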